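/- Manifolds are smooth, finite-dimensional (each of some fixed dimension), Hausdorff, second countable and without boundary. A Lie groupoid $G\rightrightarrows M$ consists of manifolds $M$ (objects) and $G$ (arrows), submersions $s,t:G\to M$ (source and target), and a smooth associative multiplication $(g_2,g_1)\mapsto g_2g_1$, defined on the submanifold of pairs with $s(g_2)=t(g_1)$, with smooth units and inverses. Its anchor is $\rho=(t,s):G\to M\times M$. A map of Lie groupoids is a pair of smooth maps on objects and on arrows that preserves source, target and multiplication. A pullback $P=X\times_B Y$ of smooth maps $f:X\to B$, $g:Y\to B$ in the category of smooth manifolds is good if it is also a pullback of the underlying topological spaces and, for all $(x,y)\in P$, the tangent space $T_{(x,y)}P$ is the pullback of $d_xf:T_xX\to T_bB$ and $d_yg:T_yY\to T_bB$, where $b=f(x)=g(y)$. A map $\phi:(G\rightrightarrows M)\to(G'\rightrightarrows M')$ is fully faithful if $\phi:G\to G'$, $\rho:G\to M\times M$, $\rho':G'\to M'\times M'$, $\phi\times\phi:M\times M\to M'\times M'$ form a good pullback square. It is essentially surjective if $G'\times_{M'}M=\{(g',x): s(g')=\phi(x)\}\to M'$, $(g',x)\mapsto t(g')$, is a surjective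 submersion. It is surjective if $\phi:M\to M'$ is a surjective submersion. A weak equivalence is a fully faithful and essentially surjective map; a surjective equivalence is a fully faithful and surjective map. Let $\phi_1:(G_1\rightrightarrows M_1)\to(G\rightrightarrows M)$ and $\phi_2:(G_2\rightrightarrows M_2)\to(G\rightrightarrows M)$ be maps of Lie groupoids. Their homotopy pullback $G_1\tilde\times_G G_2$ is the groupoid whose objects are the triples $(x_1,g,x_2)\in M_1\times G\times M_2$ with $t(g)=\phi_1(x_1)$ and $s(g)=\phi_2(x_2)$, and whose arrows are the triples $(k_1,k_2,k_3)\in G_1\times G\times G_2$ with $s(\phi_1(k_1))=t(k_2)$ and $s(k_2)=t(\phi_2(k_3))$. The source of $(k_1,k_2,k_3)$ is $(s(k_1),k_2\phi_2(k_3),s(k_3))$, its target is $(t(k_1),\phi_1(k_1)k_2,t(k_3))$, and composition is $$(l_1,l_2,l_3)(k_1,k_2,k_3)=(l_1k_1,\;k_2\phi_2(l_3)^{-1},\;l_3k_3).$$ It is said to exist (as a Lie groupoid) if its sets of objects and of arrows carry smooth structures making them the good pullbacks $M_1\times_M G\times_M M_2$ and $G_1\times_M G\times_M G_2$, and it is a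 Lie groupoid with these structures. The base-change of $\phi_1$ is then the map $\tilde\phi_1:G_1\tilde\times_G G_2\to G_2$ given by $(x_1,g,x_2)\mapsto x_2$ and $(k_1,k_2,k_3)\mapsto k_3$. **Proposition.** If $\phi_1$ is a weak equivalence, then the homotopy pullback $G_1\tilde\times_G G_2$ exists as a Lie groupoid, and the base-change $\tilde\phi_1$ of $\phi_1$ is a surjective equivalence. -/

import Mathlib

open Set Topology
open scoped Manifold ContDiff

universe u

/-! ### Good pullbacks of manifolds -/

section GoodPullback

variable
  {EP : Type*} [NormedAddCommGroup EP] [NormedSpace ℝ EP] {HP : Type*} [TopologicalSpace HP]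
  {EX : Type*} [NormedAddCommGroup EX] [NormedSpace ℝ EX] {HX : Type*} [TopologicalSpace HX]
  {EY : Type*} [NormedAddCommGroup EY] [NormedSpace ℝ EY] {HY : Type*} [TopologicalSpace HY]
  {EB : Type*} [NormedAddCommGroup EB] [NormedSpace ℝ EB] {HB : Type*} [TopologicalSpace HB]
  (IP : ModelWithCorners ℝ EP HP) (IX : ModelWithCorners ℝ EX HX)
  (IY : ModelWithCorners ℝ EY HY) (IB : ModelWithCorners ℝ EB HB)
  {P X Y B : Type u}
  [TopologicalSpace P] [ChartedSpace HP P] [TopologicalSpace X] [ChartedSpace HX X]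
  [TopologicalSpace Y] [ChartedSpace HY Y] [TopologicalSpace B] [ChartedSpace HB B]

/-- The square with legs `p : P → X`, `q : P → Y` over `f : X → B`, `g : Y → B` is a *good pullback*
of smooth manifolds: it is a pullback in the category of smooth manifolds (`lift`), it is a pullback
of the underlying topological spaces (`embedding`, `range_eq`), and it induces pullbacks between
the tangent spaces (`tangent_comm`, `tangent`). -/
structure IsGoodPullback (p : P → X) (q : P → Y) (f : X → B) (g : Y → B) : Prop where
  smooth_left : ContMDiff IP IX ∞ p
  smooth_right : ContMDiff IP IY ∞ q
  comm : ∀ z, f (p z) = g (q z)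
  lift : ∀ (n : ℕ) (Z : Type u) [TopologicalSpace Z] [T2Space Z] [SecondCountableTopology Z]
    [ChartedSpace (EuclideanSpace ℝ (Fin n)) Z] [IsManifold (𝓡 n) ∞ Z] (a : Z → X) (b : Z → Y),
    ContMDiff (𝓡 n) IX ∞ a → ContMDiff (𝓡 n) IY ∞ b → (∀ z, f (a z) = g (b z)) →
    ∃! c : Z → P, ContMDiff (𝓡 n) IP ∞ c ∧ (∀ z, p (c z) = a z) ∧ (∀ z, q (c z) = b z)
  embedding : IsEmbedding (fun z => (p z, q z))
  range_eq : range (fun z => (p z, q z)) = {w : X × Y | f w.1 = g w.2}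
  tangent_comm : ∀ (z : P) (v : TangentSpace IP z),
    (mfderiv IX IB f (p z) (mfderiv IP IX p z v) : EB)
      = (mfderiv IY IB g (q z) (mfderiv IP IY q z v) : EB)
  tangent : ∀ (z : P) (v : TangentSpace IX (p z)) (w : TangentSpace IY (q z)),
    (mfderiv IX IB f (p z) v : EB) = (mfderiv IY IB g (q z) w : EB) →
    ∃! t : TangentSpace IP z, mfderiv IP IX p z t = v ∧ mfderiv IP IY q z t = w

end GoodPullback

/-! ### Groupoids -/

/-- The algebraic structure of a groupoid with set of objects `M` and set of arrows `G`.
Arrows are composed from right to left: `mul g h` is `g` after `h`. -/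
structure GroupoidStr (M G : Type u) where
  src : G → M
  tgt : G → M
  mul : (g h : G) → src g = tgt h → G
  unit : M → G
  inv : G → G
  src_mul : ∀ g h w, src (mul g h w) = src h
  tgt_mul : ∀ g h w, tgt (mul g h w) = tgt g
  src_unit : ∀ x, src (unit x) = x
  tgt_unit : ∀ x, tgt (unit x) = x
  src_inv : ∀ g, src (inv g) = tgt g
  tgt_inv : ∀ g, tgt (inv g) = src g
  mul_assoc : ∀ g h k (w : src g = tgt h) (w' : src h = tgt k),
    mul (mul g h w) k ((src_mul g h w).trans w') = mul g (mul h k w') (w.trans (tgt_mul h k w').symm)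
  mul_unit : ∀ g, mul g (unit (src g)) (tgt_unit _).symm = g
  unit_mul : ∀ g, mul (unit (tgt g)) g (src_unit _) = g
  mul_inv : ∀ g, mul g (inv g) (tgt_inv g).symm = unit (tgt g)
  inv_mul : ∀ g, mul (inv g) g (src_inv g) = unit (src g)

namespace GroupoidStr

variable {M G : Type u} (S : GroupoidStr M G)

/-- The anchor `ρ = (t, s)`. -/
def anchor (g : G) : M × M := (S.tgt g, S.src g)

theorem mul_congr {g g' h h' : G} (hg : g = g') (hh : h = h') (w : S.src g = S.tgt h) :
    S.mul g h w = S.mul g' h' (by rw [← hg, ← hh]; exact w) := by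
  subst hg hh; rfl

theorem mul_unit' {g : G} {x : M} (w : S.src g = S.tgt (S.unit x)) :
    S.mul g (S.unit x) w = g := by
  obtain rfl : x = S.src g := by rw [w, S.tgt_unit]
  exact S.mul_unit g

theorem unit_mul' {g : G} {x : M} (w : S.src (S.unit x) = S.tgt g) :
    S.mul (S.unit x) g w = g := by
  obtain rfl : x = S.tgt g := by rw [← w, S.src_unit]
  exact S.unit_mul g

/-- An idempotent arrow is a unit. -/
theorem eq_unit_of_mul_self {g : G} (w : S.src g = S.tgt g) (h : S.mul g g w = g) :
    g = S.unit (S.src g) := by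
  have h1 := S.mul_assoc (S.inv g) g g (S.src_inv g) w
  rw [S.mul_congr (S.inv_mul g) rfl, S.unit_mul' (by rw [S.src_unit]; exact w),
    S.mul_congr rfl h, S.inv_mul] at h1
  exact h1

theorem mul_inv_cancel_right (g h : G) (w : S.src g = S.tgt h) :
    S.mul (S.mul g h w) (S.inv h) (by rw [S.src_mul, S.tgt_inv]) = g := by
  rw [S.mul_assoc g h (S.inv h) w (S.tgt_inv h).symm, S.mul_congr rfl (S.mul_inv h), S.mul_unit']

theorem inv_mul_cancel_right (g h : G) (w : S.src g = S.src h) :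
    S.mul (S.mul g (S.inv h) (by rw [S.tgt_inv, w])) h (by rw [S.src_mul, S.src_inv]) = g := by
  rw [S.mul_assoc g (S.inv h) h (by rw [S.tgt_inv, w]) (S.src_inv h), S.mul_congr rfl (S.inv_mul h),
    S.mul_unit']

theorem inv_mul_cancel_left (g h : G) (w : S.src g = S.tgt h) :
    S.mul (S.inv g) (S.mul g h w) (by rw [S.src_inv, S.tgt_mul]) = h := by
  rw [← S.mul_assoc (S.inv g) g h (S.src_inv g) w, S.mul_congr (S.inv_mul g) rfl, S.unit_mul']

theorem eq_inv_of_mul {g h : G} (w : S.src g = S.tgt h) (e : S.mul g h w = S.unit (S.tgt g)) :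
    h = S.inv g := by
  rw [← S.inv_mul_cancel_left g h w, S.mul_congr rfl e, S.mul_unit']

theorem inv_inv (g : G) : S.inv (S.inv g) = g :=
  (S.eq_inv_of_mul (S.src_inv g) (by rw [S.inv_mul, S.tgt_inv])).symm

theorem inv_unit (x : M) : S.inv (S.unit x) = S.unit x :=
  (S.eq_inv_of_mul (by rw [S.src_unit, S.tgt_unit]) (by rw [S.mul_unit', S.tgt_unit])).symm

theorem inv_mul_rev (g h : G) (w : S.src g = S.tgt h) :
    S.inv (S.mul g h w) = S.mul (S.inv h) (S.inv g) (by rw [S.src_inv, S.tgt_inv, w]) := by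
  refine (S.eq_inv_of_mul (by rw [S.src_mul, S.tgt_mul, S.tgt_inv]) ?_).symm
  rw [← S.mul_assoc (S.mul g h w) (S.inv h) (S.inv g) (by rw [S.src_mul, S.tgt_inv])
    (by rw [S.src_inv, S.tgt_inv, w]), S.mul_congr (S.mul_inv_cancel_right g h w) rfl, S.mul_inv,
    S.tgt_mul]

variable {dM dG : ℕ}
  [TopologicalSpace M] [ChartedSpace (EuclideanSpace ℝ (Fin dM)) M]
  [TopologicalSpace G] [ChartedSpace (EuclideanSpace ℝ (Fin dG)) G]

variable (dM dG) in
/-- The structural maps are smooth, and source and target are submersions. Smoothness of the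
multiplication refers to the embedded submanifold of composable pairs in `G × G`. -/
structure IsLie : Prop where
  src_submersion : Manifold.IsSubmersion (𝓡 dG) (𝓡 dM) ∞ S.src
  tgt_submersion : Manifold.IsSubmersion (𝓡 dG) (𝓡 dM) ∞ S.tgt
  smooth_mul : ∃ F : G × G → G,
    ContMDiffOn ((𝓡 dG).prod (𝓡 dG)) (𝓡 dG) ∞ F {p | S.src p.1 = S.tgt p.2} ∧
      ∀ g h w, F (g, h) = S.mul g h w
  smooth_unit : ContMDiff (𝓡 dM) (𝓡 dG) ∞ S.unit
  smooth_inv : ContMDiff (𝓡 dG) (𝓡 dG) ∞ S.inv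

end GroupoidStr

/-- A Lie groupoid `Ar ⇉ Ob`: objects and arrows are smooth manifolds without boundary
(Hausdorff, second countable, of some finite dimension). -/
structure LieGroupoid where
  Ob : Type u
  Ar : Type u
  dimOb : ℕ
  dimAr : ℕ
  [topOb : TopologicalSpace Ob]
  [t2Ob : T2Space Ob]
  [scOb : SecondCountableTopology Ob]
  [chartedOb : ChartedSpace (EuclideanSpace ℝ (Fin dimOb)) Ob]
  [mfdOb : IsManifold (𝓡 dimOb) ∞ Ob]
  [topAr : TopologicalSpace Ar]
  [t2Ar : T2Space Ar]
  [scAr : SecondCountableTopology Ar]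
  [chartedAr : ChartedSpace (EuclideanSpace ℝ (Fin dimAr)) Ar]
  [mfdAr : IsManifold (𝓡 dimAr) ∞ Ar]
  str : GroupoidStr Ob Ar
  isLie : str.IsLie dimOb dimAr

namespace LieGroupoid

attribute [instance] topOb t2Ob scOb chartedOb mfdOb topAr t2Ar scAr chartedAr mfdAr

/-- A map of Lie groupoids. -/
structure Hom (A B : LieGroupoid.{u}) where
  ob : A.Ob → B.Ob
  ar : A.Ar → B.Ar
  smooth_ob : ContMDiff (𝓡 A.dimOb) (𝓡 B.dimOb) ∞ ob
  smooth_ar : ContMDiff (𝓡 A.dimAr) (𝓡 B.dimAr) ∞ ar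
  src_ar : ∀ g, B.str.src (ar g) = ob (A.str.src g)
  tgt_ar : ∀ g, B.str.tgt (ar g) = ob (A.str.tgt g)
  map_mul : ∀ g h (w : A.str.src g = A.str.tgt h),
    ar (A.str.mul g h w) = B.str.mul (ar g) (ar h) (by rw [src_ar, tgt_ar, w])

namespace Hom

variable {A B : LieGroupoid.{u}} (φ : Hom A B)

theorem map_unit (x : A.Ob) : φ.ar (A.str.unit x) = B.str.unit (φ.ob x) := by
  have w : A.str.src (A.str.unit x) = A.str.tgt (A.str.unit x) := by
    rw [A.str.src_unit, A.str.tgt_unit]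
  have h := B.str.eq_unit_of_mul_self (g := φ.ar (A.str.unit x))
    (by rw [φ.src_ar, φ.tgt_ar, w]) (by rw [← φ.map_mul _ _ w, A.str.mul_unit'])
  rwa [φ.src_ar, A.str.src_unit] at h

theorem map_inv (g : A.Ar) : φ.ar (A.str.inv g) = B.str.inv (φ.ar g) := by
  refine B.str.eq_inv_of_mul (by rw [φ.src_ar, φ.tgt_ar, A.str.tgt_inv]) ?_
  rw [← φ.map_mul _ _ (A.str.tgt_inv g).symm, A.str.mul_inv, φ.map_unit, φ.tgt_ar]

/-- `φ` is fully faithful: the square formed by `φ` and the anchors is a good pullback. -/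
def IsFullyFaithful : Prop :=
  IsGoodPullback (𝓡 A.dimAr) (𝓡 B.dimAr) ((𝓡 A.dimOb).prod (𝓡 A.dimOb))
    ((𝓡 B.dimOb).prod (𝓡 B.dimOb)) φ.ar A.str.anchor B.str.anchor (Prod.map φ.ob φ.ob)

/-- The fibre product of `s : B.Ar → B.Ob` and `φ : A.Ob → B.Ob`. -/
abbrev ArrowsFrom : Type u := {p : B.Ar × A.Ob // B.str.src p.1 = φ.ob p.2}

/-- `φ` is essentially surjective: with its smooth structure as a good pullback of `s` and `φ`
on objects, the map `(y ← φ(x), x) ↦ y` is a surjective submersion. -/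
def IsEssentiallySurjective : Prop :=
  ∃ (n : ℕ) (_ : ChartedSpace (EuclideanSpace ℝ (Fin n)) φ.ArrowsFrom)
    (_ : IsManifold (𝓡 n) ∞ φ.ArrowsFrom),
    IsGoodPullback (𝓡 n) (𝓡 B.dimAr) (𝓡 A.dimOb) (𝓡 B.dimOb)
      (fun p : φ.ArrowsFrom => p.1.1) (fun p : φ.ArrowsFrom => p.1.2) B.str.src φ.ob ∧
    Function.Surjective (fun p : φ.ArrowsFrom => B.str.tgt p.1.1) ∧
    Manifold.IsSubmersion (𝓡 n) (𝓡 B.dimOb) ∞ (fun p : φ.ArrowsFrom => B.str.tgt p.1.1)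

/-- `φ` is a weak equivalence. -/
def IsWeakEquivalence : Prop := φ.IsFullyFaithful ∧ φ.IsEssentiallySurjective

/-- `φ` is surjective: it is a surjective submersion on objects. -/
def IsSurjective : Prop :=
  Function.Surjective φ.ob ∧ Manifold.IsSubmersion (𝓡 A.dimOb) (𝓡 B.dimOb) ∞ φ.ob

/-- `φ` is a surjective equivalence. -/
def IsSurjectiveEquivalence : Prop := φ.IsSurjective ∧ φ.IsFullyFaithful

end Hom

/-! ### Homotopy pullbacks -/

section HomotopyPullback

variable {G G₁ G₂ : LieGroupoid.{u}} (φ₁ : Hom G₁ G) (φ₂ : Hom G₂ G)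

/-- Objects of the homotopy pullback: triples `(x₁, φ₁(x₁) ←g— φ₂(x₂), x₂)`. -/
abbrev HPullOb : Type u :=
  {p : G₁.Ob × G.Ar × G₂.Ob // G.str.tgt p.2.1 = φ₁.ob p.1 ∧ G.str.src p.2.1 = φ₂.ob p.2.2}

/-- Arrows of the homotopy pullback: triples `(k₁, k₂, k₃)` with `k₁ : x₁ → y₁`,
`k₂ : φ₂(y₂) → φ₁(x₁)` and `k₃ : x₂ → y₂`. -/
abbrev HPullAr : Type u :=
  {k : G₁.Ar × G.Ar × G₂.Ar //
    G.str.src (φ₁.ar k.1) = G.str.tgt k.2.1 ∧ G.str.src k.2.1 = G.str.tgt (φ₂.ar k.2.2)}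

variable {φ₁ φ₂}

/-- The source of `(k₁, k₂, k₃)` is `(s(k₁), k₂ φ₂(k₃), s(k₃))`. -/
def hpullSrc (k : HPullAr φ₁ φ₂) : HPullOb φ₁ φ₂ :=
  ⟨(G₁.str.src k.1.1, G.str.mul k.1.2.1 (φ₂.ar k.1.2.2) k.2.2, G₂.str.src k.1.2.2),
    (G.str.tgt_mul _ _ _).trans (k.2.1.symm.trans (φ₁.src_ar _)),
    (G.str.src_mul _ _ _).trans (φ₂.src_ar _)⟩

/-- The target of `(k₁, k₂, k₃)` is `(t(k₁), φ₁(k₁) k₂, t(k₃))`. -/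
def hpullTgt (k : HPullAr φ₁ φ₂) : HPullOb φ₁ φ₂ :=
  ⟨(G₁.str.tgt k.1.1, G.str.mul (φ₁.ar k.1.1) k.1.2.1 k.2.1, G₂.str.tgt k.1.2.2),
    (G.str.tgt_mul _ _ _).trans (φ₁.tgt_ar _),
    (G.str.src_mul _ _ _).trans (k.2.2.trans (φ₂.tgt_ar _))⟩

theorem hpullOb_ext {p q : HPullOb φ₁ φ₂} (h₁ : p.1.1 = q.1.1) (h₂ : p.1.2.1 = q.1.2.1)
    (h₃ : p.1.2.2 = q.1.2.2) : p = q :=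
  Subtype.ext (Prod.ext h₁ (Prod.ext h₂ h₃))

theorem hpullAr_ext {k l : HPullAr φ₁ φ₂} (h₁ : k.1.1 = l.1.1) (h₂ : k.1.2.1 = l.1.2.1)
    (h₃ : k.1.2.2 = l.1.2.2) : k = l :=
  Subtype.ext (Prod.ext h₁ (Prod.ext h₂ h₃))

theorem hpull_comp₁ {l k : HPullAr φ₁ φ₂} (w : hpullSrc l = hpullTgt k) :
    G₁.str.src l.1.1 = G₁.str.tgt k.1.1 :=
  congrArg (fun p : HPullOb φ₁ φ₂ => p.1.1) w

theorem hpull_comp₂ {l k : HPullAr φ₁ φ₂} (w : hpullSrc l = hpullTgt k) :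
    G.str.mul l.1.2.1 (φ₂.ar l.1.2.2) l.2.2 = G.str.mul (φ₁.ar k.1.1) k.1.2.1 k.2.1 :=
  congrArg (fun p : HPullOb φ₁ φ₂ => p.1.2.1) w

theorem hpull_comp₃ {l k : HPullAr φ₁ φ₂} (w : hpullSrc l = hpullTgt k) :
    G₂.str.src l.1.2.2 = G₂.str.tgt k.1.2.2 :=
  congrArg (fun p : HPullOb φ₁ φ₂ => p.1.2.2) w

theorem hpull_mid {l k : HPullAr φ₁ φ₂} (w : hpullSrc l = hpullTgt k) :
    G.str.src k.1.2.1 = G.str.tgt (G.str.inv (φ₂.ar l.1.2.2)) := by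
  rw [G.str.tgt_inv, k.2.2, φ₂.tgt_ar, φ₂.src_ar, hpull_comp₃ w]

/-- `(l₁, l₂, l₃) (k₁, k₂, k₃) = (l₁ k₁, k₂ φ₂(l₃)⁻¹, l₃ k₃)`. -/
def hpullMul (l k : HPullAr φ₁ φ₂) (w : hpullSrc l = hpullTgt k) : HPullAr φ₁ φ₂ :=
  ⟨(G₁.str.mul l.1.1 k.1.1 (hpull_comp₁ w),
    G.str.mul k.1.2.1 (G.str.inv (φ₂.ar l.1.2.2)) (hpull_mid w),
    G₂.str.mul l.1.2.2 k.1.2.2 (hpull_comp₃ w)), by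
    constructor
    · dsimp only
      rw [φ₁.src_ar, G₁.str.src_mul, ← φ₁.src_ar, G.str.tgt_mul]
      exact k.2.1
    · dsimp only
      rw [G.str.src_mul, G.str.src_inv, φ₂.map_mul, G.str.tgt_mul]⟩

/-- The unit at `(x₁, g, x₂)` is `(1, g, 1)`. -/
def hpullUnit (p : HPullOb φ₁ φ₂) : HPullAr φ₁ φ₂ :=
  ⟨(G₁.str.unit p.1.1, p.1.2.1, G₂.str.unit p.1.2.2), by
    constructor
    · dsimp only
      rw [φ₁.map_unit, G.str.src_unit]
      exact p.2.1.symm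
    · dsimp only
      rw [φ₂.map_unit, G.str.tgt_unit]
      exact p.2.2⟩

theorem hpull_inv_aux (k : HPullAr φ₁ φ₂) :
    G.str.src (φ₁.ar k.1.1) = G.str.tgt (G.str.mul k.1.2.1 (φ₂.ar k.1.2.2) k.2.2) :=
  k.2.1.trans (G.str.tgt_mul _ _ _).symm

/-- The inverse of `(k₁, k₂, k₃)` is `(k₁⁻¹, φ₁(k₁) k₂ φ₂(k₃), k₃⁻¹)`. -/
def hpullInv (k : HPullAr φ₁ φ₂) : HPullAr φ₁ φ₂ :=
  ⟨(G₁.str.inv k.1.1,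
    G.str.mul (φ₁.ar k.1.1) (G.str.mul k.1.2.1 (φ₂.ar k.1.2.2) k.2.2) (hpull_inv_aux k),
    G₂.str.inv k.1.2.2), by
    constructor
    · dsimp only
      rw [φ₁.map_inv, G.str.src_inv, G.str.tgt_mul]
    · dsimp only
      rw [φ₂.map_inv, G.str.tgt_inv, G.str.src_mul, G.str.src_mul]⟩

theorem hpull_src_mul (l k : HPullAr φ₁ φ₂) (w : hpullSrc l = hpullTgt k) :
    hpullSrc (hpullMul l k w) = hpullSrc k := by
  refine hpullOb_ext (G₁.str.src_mul _ _ _) ?_ (G₂.str.src_mul _ _ _)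
  dsimp only [hpullSrc, hpullMul]
  have h3 : G.str.src (φ₂.ar l.1.2.2) = G.str.tgt (φ₂.ar k.1.2.2) := by
    rw [φ₂.src_ar, φ₂.tgt_ar, hpull_comp₃ w]
  have h4 : G.str.src k.1.2.1 = G.str.src (φ₂.ar l.1.2.2) := k.2.2.trans h3.symm
  refine (G.str.mul_congr rfl (φ₂.map_mul _ _ (hpull_comp₃ w)) _).trans ?_
  rw [← G.str.mul_assoc _ _ _ (by rw [G.str.src_mul, G.str.src_inv]) h3,
    G.str.mul_congr (G.str.inv_mul_cancel_right _ _ h4) rfl]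

theorem hpull_tgt_mul (l k : HPullAr φ₁ φ₂) (w : hpullSrc l = hpullTgt k) :
    hpullTgt (hpullMul l k w) = hpullTgt l := by
  refine hpullOb_ext (G₁.str.tgt_mul _ _ _) ?_ (G₂.str.tgt_mul _ _ _)
  dsimp only [hpullTgt, hpullMul]
  have h1 : G.str.src (φ₁.ar l.1.1) = G.str.tgt (φ₁.ar k.1.1) := by
    rw [φ₁.src_ar, φ₁.tgt_ar, hpull_comp₁ w]
  have h5 : G.str.src (G.str.mul (φ₁.ar k.1.1) k.1.2.1 k.2.1)
      = G.str.tgt (G.str.inv (φ₂.ar l.1.2.2)) := (G.str.src_mul _ _ _).trans (hpull_mid w)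
  refine (G.str.mul_congr (φ₁.map_mul _ _ (hpull_comp₁ w)) rfl _).trans ?_
  rw [G.str.mul_assoc _ _ _ h1 (k.2.1.trans (G.str.tgt_mul _ _ _).symm),
    G.str.mul_congr rfl (G.str.mul_assoc _ _ _ k.2.1 (hpull_mid w)).symm,
    G.str.mul_congr rfl (G.str.mul_congr (hpull_comp₂ w).symm rfl h5),
    G.str.mul_congr rfl (G.str.mul_inv_cancel_right _ _ l.2.2)]

theorem hpull_src_unit (p : HPullOb φ₁ φ₂) : hpullSrc (hpullUnit p) = p := by
  refine hpullOb_ext (G₁.str.src_unit _) ?_ (G₂.str.src_unit _)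
  dsimp only [hpullSrc, hpullUnit]
  exact (G.str.mul_congr rfl (φ₂.map_unit _) _).trans (G.str.mul_unit' _)

theorem hpull_tgt_unit (p : HPullOb φ₁ φ₂) : hpullTgt (hpullUnit p) = p := by
  refine hpullOb_ext (G₁.str.tgt_unit _) ?_ (G₂.str.tgt_unit _)
  dsimp only [hpullTgt, hpullUnit]
  exact (G.str.mul_congr (φ₁.map_unit _) rfl _).trans (G.str.unit_mul' _)

theorem hpull_src_inv (k : HPullAr φ₁ φ₂) : hpullSrc (hpullInv k) = hpullTgt k := by
  refine hpullOb_ext (G₁.str.src_inv _) ?_ (G₂.str.src_inv _)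
  dsimp only [hpullSrc, hpullTgt, hpullInv]
  exact (G.str.mul_congr (G.str.mul_assoc _ _ _ k.2.1 k.2.2).symm (φ₂.map_inv _) _).trans
    (G.str.mul_inv_cancel_right _ _ ((G.str.src_mul _ _ _).trans k.2.2))

theorem hpull_tgt_inv (k : HPullAr φ₁ φ₂) : hpullTgt (hpullInv k) = hpullSrc k := by
  refine hpullOb_ext (G₁.str.tgt_inv _) ?_ (G₂.str.tgt_inv _)
  dsimp only [hpullSrc, hpullTgt, hpullInv]
  exact (G.str.mul_congr (φ₁.map_inv _) rfl _).trans
    (G.str.inv_mul_cancel_left _ _ (hpull_inv_aux k))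

/-- The homotopy pullback `G₁ ×̃_G G₂` as a groupoid of sets. -/
def hpullStr : GroupoidStr (HPullOb φ₁ φ₂) (HPullAr φ₁ φ₂) where
  src := hpullSrc
  tgt := hpullTgt
  mul := hpullMul
  unit := hpullUnit
  inv := hpullInv
  src_mul := hpull_src_mul
  tgt_mul := hpull_tgt_mul
  src_unit := hpull_src_unit
  tgt_unit := hpull_tgt_unit
  src_inv := hpull_src_inv
  tgt_inv := hpull_tgt_inv
  mul_assoc j l k w w' := by
    refine hpullAr_ext (G₁.str.mul_assoc _ _ _ (hpull_comp₁ w) (hpull_comp₁ w')) ?_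
      (G₂.str.mul_assoc _ _ _ (hpull_comp₃ w) (hpull_comp₃ w'))
    dsimp only [hpullMul]
    have h3 : G.str.src (φ₂.ar j.1.2.2) = G.str.tgt (φ₂.ar l.1.2.2) := by
      rw [φ₂.src_ar, φ₂.tgt_ar, hpull_comp₃ w]
    rw [G.str.mul_assoc _ _ _ (hpull_mid w') (by rw [G.str.src_inv, G.str.tgt_inv, h3])]
    refine G.str.mul_congr rfl ?_ _
    rw [φ₂.map_mul, G.str.inv_mul_rev]
  mul_unit k := by
    refine hpullAr_ext (G₁.str.mul_unit _) ?_ (G₂.str.mul_unit _)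
    exact G.str.mul_inv_cancel_right _ _ k.2.2
  unit_mul k := by
    refine hpullAr_ext (G₁.str.unit_mul _) ?_ (G₂.str.unit_mul _)
    dsimp only [hpullMul, hpullUnit]
    exact (G.str.mul_congr rfl ((congrArg _ (φ₂.map_unit _)).trans (G.str.inv_unit _)) _).trans
      (G.str.mul_unit' _)
  mul_inv k := by
    refine hpullAr_ext (G₁.str.mul_inv _) ?_ (G₂.str.mul_inv _)
    dsimp only [hpullMul, hpullInv, hpullUnit, hpullTgt]
    exact (G.str.mul_congr (G.str.mul_assoc _ _ _ k.2.1 k.2.2).symm rfl _).trans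
      (G.str.mul_inv_cancel_right _ _ ((G.str.src_mul _ _ _).trans k.2.2))
  inv_mul k := by
    refine hpullAr_ext (G₁.str.inv_mul _) ?_ (G₂.str.inv_mul _)
    dsimp only [hpullMul, hpullInv, hpullUnit, hpullSrc]
    refine G.str.mul_congr rfl ?_ _
    rw [φ₂.map_inv, G.str.inv_inv]

variable (φ₁ φ₂) in
/-- A smooth structure exhibiting `G₁ ×̃_G G₂` as a Lie groupoid whose objects and arrows are the
good pullbacks of manifolds `M₁ ×_M G ×_M M₂` and `G₁ ×_M G ×_M G₂`; the homotopy pullback *exists*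
if there is such a structure. The topologies are the subspace topologies. -/
structure HomotopyPullback where
  dimOb : ℕ
  dimAr : ℕ
  [chartedOb : ChartedSpace (EuclideanSpace ℝ (Fin dimOb)) (HPullOb φ₁ φ₂)]
  [mfdOb : IsManifold (𝓡 dimOb) ∞ (HPullOb φ₁ φ₂)]
  [chartedAr : ChartedSpace (EuclideanSpace ℝ (Fin dimAr)) (HPullAr φ₁ φ₂)]
  [mfdAr : IsManifold (𝓡 dimAr) ∞ (HPullAr φ₁ φ₂)]
  /-- `(x₁, g, x₂)` with `φ₁(x₁) = t(g)` and `φ₂(x₂) = s(g)` -/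
  pullbackOb : IsGoodPullback (𝓡 dimOb) ((𝓡 G₁.dimOb).prod (𝓡 G₂.dimOb)) (𝓡 G.dimAr)
    ((𝓡 G.dimOb).prod (𝓡 G.dimOb))
    (fun p : HPullOb φ₁ φ₂ => (p.1.1, p.1.2.2)) (fun p : HPullOb φ₁ φ₂ => p.1.2.1)
    (Prod.map φ₁.ob φ₂.ob) G.str.anchor
  /-- `(k₁, k₂, k₃)` with `s(φ₁(k₁)) = t(k₂)` and `t(φ₂(k₃)) = s(k₂)` -/
  pullbackAr : IsGoodPullback (𝓡 dimAr) ((𝓡 G₁.dimAr).prod (𝓡 G₂.dimAr)) (𝓡 G.dimAr)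
    ((𝓡 G.dimOb).prod (𝓡 G.dimOb))
    (fun k : HPullAr φ₁ φ₂ => (k.1.1, k.1.2.2)) (fun k : HPullAr φ₁ φ₂ => k.1.2.1)
    (Prod.map (fun k₁ => G.str.src (φ₁.ar k₁)) (fun k₃ => G.str.tgt (φ₂.ar k₃))) G.str.anchor
  isLie : (hpullStr (φ₁ := φ₁) (φ₂ := φ₂)).IsLie dimOb dimAr

namespace HomotopyPullback

/-- The homotopy pullback as a Lie groupoid. -/
abbrev toLieGroupoid (P : HomotopyPullback φ₁ φ₂) : LieGroupoid.{u} :=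
  letI := P.chartedOb
  letI := P.chartedAr
  haveI := P.mfdOb
  haveI := P.mfdAr
  haveI : SecondCountableTopology (HPullOb φ₁ φ₂) :=
    TopologicalSpace.Subtype.secondCountableTopology _
  haveI : SecondCountableTopology (HPullAr φ₁ φ₂) :=
    TopologicalSpace.Subtype.secondCountableTopology _
  { Ob := HPullOb φ₁ φ₂
    Ar := HPullAr φ₁ φ₂
    dimOb := P.dimOb
    dimAr := P.dimAr
    str := hpullStr
    isLie := P.isLie }

/-- The base-change `φ̃₁ : G₁ ×̃_G G₂ → G₂` of `φ₁`, given by `(x₁, g, x₂) ↦ x₂` on objects and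
`(k₁, k₂, k₃) ↦ k₃` on arrows. -/
def baseChange (P : HomotopyPullback φ₁ φ₂) : Hom P.toLieGroupoid G₂ where
  ob p := p.1.2.2
  ar k := k.1.2.2
  smooth_ob := by
    let := P.chartedOb
    exact P.pullbackOb.smooth_left.snd
  smooth_ar := by
    let := P.chartedAr
    exact P.pullbackAr.smooth_left.snd
  src_ar _ := rfl
  tgt_ar _ := rfl
  map_mul _ _ _ := rfl

end HomotopyPullback

end HomotopyPullback

end LieGroupoid

/-! Write `φ₁ : G₁ → G`, with `M`, `M₁`, `M₂` the objects. The objects of the homotopy pullback are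
the fibre product of `φ₁ × φ₂ : M₁ × M₂ → M × M` with the anchor `(t, s)` of `G`. Essential
surjectivity makes these maps transversal: differentiating the submersion `(g, x) ↦ t(g)` shows that
at an arrow `g` ending at `φ₁(x)` there are tangent vectors with any prescribed image under `ds` and
with image under `dt` in that of `dφ₁` (`Hom.IsEssentiallySurjective.exists_modelDeriv`). The
submersion `t` takes care of the other factor of `M × M`. The maps defining the arrows factor
through the submersion `s × t` followed by `φ₁ × φ₂` on objects, so transversality persists
(`isTransversal_arrows`). A transversal fibre product is an embedded submanifold with the expected
tangent spaces, hence a good pullback (`IsTransversal.exists_isGoodPullback`).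

A map into a good pullback is smooth as soon as its two components are
(`IsGoodPullback.contMDiffOn`), so the structural maps are smooth because their formulas are. Local
sections of the sources of `G₁` and `G₂` give local sections of the source of the homotopy pullback,
and the target is the source after inversion; both are therefore submersions (`isLie_hpullStr`).

For the base-change, essential surjectivity gives surjectivity on objects and, infinitesimally,
surjectivity of derivatives. For full faithfulness, an arrow over `k₃` from `a = (x₁, g, x₂)` to `b
= (y₁, g', y₂)` must have `k₂ = g φ₂(k₃)⁻¹` and `φ₁(k₁) = g' k₂⁻¹`. Full faithfulness of `φ₁` turns
the latter into a unique `k₁ : x₁ → y₁` depending smoothly on the data. Thus the arrows are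
identified, smoothly in both directions, with a fibre product that is transversal because the
base-change is a submersion on objects; `IsTransversal.isGoodPullback_of_inverse` concludes. Only
the good pullback properties enter, so the conclusion holds for every admissible smooth structure on
the homotopy pullback. -/

/-! ### Consequences of the inverse function theorem -/

section InverseFunction

/-- The inverse function theorem for smooth maps, with smoothness of the inverse on a whole
neighbourhood. -/
theorem exists_openPartialHomeomorph_of_hasFDerivAt_equiv {E F : Type*}
    [NormedAddCommGroup E] [NormedSpace ℝ E] [CompleteSpace E]
    [NormedAddCommGroup F] [NormedSpace ℝ F] {f : E → F} {U : Set E} (hU : IsOpen U)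
    (hf : ContDiffOn ℝ ∞ f U) {a : E} (ha : a ∈ U) {f' : E ≃L[ℝ] F}
    (hf' : HasFDerivAt f (f' : E →L[ℝ] F) a) :
    ∃ e : OpenPartialHomeomorph E F, a ∈ e.source ∧ e.source ⊆ U ∧ (∀ x, e x = f x) ∧
      ContDiffOn ℝ ∞ e.symm e.target := by
  have hfa : ContDiffAt ℝ ∞ f a := hf.contDiffAt (hU.mem_nhds ha)
  -- At a single point the inverse function theorem gives smoothness of the inverse only there. On
  -- `V` the derivative is invertible everywhere, and `V` is open because invertible operators form
  -- an open set.
  set V : Set E := U ∩ fderiv ℝ f ⁻¹' range ((↑) : (E ≃L[ℝ] F) → E →L[ℝ] F) with hV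
  have hVo : IsOpen V :=
    (hf.continuousOn_fderiv_of_isOpen hU (by simp)).isOpen_inter_preimage hU
      ContinuousLinearEquiv.isOpen
  set e := (hfa.toOpenPartialHomeomorph f hf' (by simp)).restrOpen V hVo with he
  have hes : e.source ⊆ V := fun x hx => by
    rw [he, OpenPartialHomeomorph.restrOpen_source] at hx
    exact hx.2
  refine ⟨e, ?_, fun x hx => (hes hx).1, fun _ => rfl, fun y hy => ?_⟩
  · rw [he, OpenPartialHomeomorph.restrOpen_source]
    exact ⟨hfa.mem_toOpenPartialHomeomorph_source hf' _, ha, f', hf'.fderiv.symm⟩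
  · obtain ⟨hxU, L, hL⟩ := hes (e.map_target hy)
    have hd : ContDiffAt ℝ ∞ f (e.symm y) := hf.contDiffAt (hU.mem_nhds hxU)
    refine (e.contDiffAt_symm hy (f₀' := L) ?_ hd).contDiffWithinAt
    rw [hL]
    exact (hd.differentiableAt (by simp)).hasFDerivAt

/-- A surjective linear map of finite-dimensional spaces is a projection up to isomorphism. -/
theorem ContinuousLinearMap.exists_equiv_prod_of_surjective {E V F : Type*}
    [NormedAddCommGroup E] [NormedSpace ℝ E] [FiniteDimensional ℝ E]
    [NormedAddCommGroup V] [NormedSpace ℝ V] [FiniteDimensional ℝ V]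
    [NormedAddCommGroup F] [NormedSpace ℝ F] [FiniteDimensional ℝ F]
    (D : E →L[ℝ] V) (hD : Function.Surjective D)
    (hdim : Module.finrank ℝ E = Module.finrank ℝ V + Module.finrank ℝ F) :
    ∃ L : E ≃L[ℝ] V × F, ∀ v, (L v).1 = D v := by
  have hker : Module.finrank ℝ (LinearMap.ker (D : E →ₗ[ℝ] V)) = Module.finrank ℝ F := by
    have h1 := LinearMap.finrank_range_add_finrank_ker (D : E →ₗ[ℝ] V)
    rw [LinearMap.range_eq_top.2 hD, finrank_top] at h1
    omega
  -- `F` has the dimension of the kernel of `D`. Projecting to the kernel along a complement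
  -- supplies the missing coordinates, and `(D, K)` is injective since `K` is injective on the
  -- kernel.
  obtain ⟨Q, hQ⟩ := Submodule.exists_isCompl (LinearMap.ker (D : E →ₗ[ℝ] V))
  let κ := LinearEquiv.ofFinrankEq _ _ hker
  let K : E →ₗ[ℝ] F := κ.toLinearMap ∘ₗ Submodule.projectionOnto _ Q hQ
  let T : E →ₗ[ℝ] V × F := (D : E →ₗ[ℝ] V).prod K
  have hinj : Function.Injective T := by
    rw [injective_iff_map_eq_zero]
    intro v hv
    have h1 : D v = 0 := congrArg Prod.fst hv
    have h2 : K v = 0 := congrArg Prod.snd hv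
    have h3 : Submodule.projectionOnto _ Q hQ v = 0 := by
      simpa [K] using h2
    have h4 := Submodule.projectionOnto_apply_left hQ ⟨v, h1⟩
    rw [h3] at h4
    exact (congrArg Subtype.val h4).symm
  let e := LinearEquiv.ofInjectiveOfFinrankEq T hinj (by simp [hdim])
  exact ⟨e.toContinuousLinearEquiv, fun v => rfl⟩

variable {E : Type*} [NormedAddCommGroup E] [NormedSpace ℝ E] [FiniteDimensional ℝ E]
  {H : Type*} [TopologicalSpace H] {I : ModelWithCorners ℝ E H} [I.Boundaryless]
  {N : Type*} [TopologicalSpace N] [ChartedSpace H N] [IsManifold I ∞ N]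

/-- Near a point where its derivative is surjective, a smooth map to a vector space is the first
component of a diffeomorphism onto an open set of a product. -/
theorem exists_straightening {V F : Type*}
    [NormedAddCommGroup V] [NormedSpace ℝ V] [FiniteDimensional ℝ V]
    [NormedAddCommGroup F] [NormedSpace ℝ F] [FiniteDimensional ℝ F]
    {h : N → V} {U : Set N} (hU : IsOpen U) (hh : ContMDiffOn I 𝓘(ℝ, V) ∞ h U) {a : N} (ha : a ∈ U)
    (hs : Function.Surjective (mfderiv I 𝓘(ℝ, V) h a))
    (hdim : Module.finrank ℝ E = Module.finrank ℝ V + Module.finrank ℝ F) :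
    ∃ Φ : OpenPartialHomeomorph N (V × F), a ∈ Φ.source ∧ Φ.source ⊆ U ∧
      (∀ x ∈ Φ.source, (Φ x).1 = h x) ∧ ContMDiffOn I 𝓘(ℝ, V × F) ∞ Φ Φ.source ∧
      ContMDiffOn 𝓘(ℝ, V × F) I ∞ Φ.symm Φ.target := by
  have : CompleteSpace E := FiniteDimensional.complete ℝ E
  set c : OpenPartialHomeomorph N E :=
    (chartAt H a).trans I.toHomeomorph.toOpenPartialHomeomorph with hc
  have hcs : c.source = (chartAt H a).source := by simp [hc]
  have hct : c.target = (extChartAt I a).target := by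
    ext y; simp [hc, I.range_eq_univ]
  have hcc : ContMDiffOn I 𝓘(ℝ, E) ∞ c c.source := by
    rw [hcs]; exact contMDiffOn_extChartAt
  have hcc' : ContMDiffOn 𝓘(ℝ, E) I ∞ c.symm c.target := by
    rw [hct]; exact contMDiffOn_extChartAt_symm a
  have hac : a ∈ c.source := by rw [hcs]; exact mem_chart_source H a
  set W : Set E := c.target ∩ c.symm ⁻¹' U with hW
  have hWo : IsOpen W := c.symm.isOpen_inter_preimage hU
  have haW : c a ∈ W := ⟨c.map_source hac, by simpa [c.left_inv hac] using ha⟩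
  have hg : ContDiffOn ℝ ∞ (h ∘ c.symm) W :=
    (hh.comp (hcc'.mono inter_subset_left) fun x hx => hx.2).contDiffOn
  have hgd : DifferentiableAt ℝ (h ∘ c.symm) (c a) :=
    (hg.contDiffAt (hWo.mem_nhds haW)).differentiableAt (by simp)
  have hma : MDifferentiableAt I 𝓘(ℝ, V) h a :=
    (hh.contMDiffAt (hU.mem_nhds ha)).mdifferentiableAt (by simp)
  have hD : Function.Surjective (fderiv ℝ (h ∘ c.symm) (c a)) := by
    have h1 := hma.hasMFDerivAt.2
    rw [I.range_eq_univ] at h1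
    let D : E →L[ℝ] V := mfderiv I 𝓘(ℝ, V) h a
    have h2 : HasFDerivAt (h ∘ c.symm) D (c a) := hasFDerivWithinAt_univ.1 h1
    rw [h2.fderiv]
    exact hs
  obtain ⟨L, hL⟩ := ContinuousLinearMap.exists_equiv_prod_of_surjective _ hD hdim
  -- The second component is linear, chosen so that the derivative of `f` at `c a` is exactly the
  -- isomorphism `L`.
  set f : E → V × F := fun v => ((h ∘ c.symm) v, (L v).2) with hf
  have hfd : HasFDerivAt f (L : E →L[ℝ] V × F) (c a) := by
    have h2 : HasFDerivAt (fun v => (L v).2)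
        ((ContinuousLinearMap.snd ℝ V F).comp (L : E →L[ℝ] V × F)) (c a) :=
      ((ContinuousLinearMap.snd ℝ V F).comp (L : E →L[ℝ] V × F)).hasFDerivAt
    convert hgd.hasFDerivAt.prodMk h2 using 1
    ext v
    · exact hL v
    · rfl
  have hfs : ContDiffOn ℝ ∞ f W :=
    hg.prodMk ((ContinuousLinearMap.snd ℝ V F).comp (L : E →L[ℝ] V × F)).contDiff.contDiffOn
  obtain ⟨e, hae, heW, hef, hes⟩ :=
    exists_openPartialHomeomorph_of_hasFDerivAt_equiv hWo hfs haW hfd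
  have hsrc : ∀ x, x ∈ (c.trans e).source ↔ x ∈ c.source ∧ c x ∈ e.source := fun x => by
    rw [OpenPartialHomeomorph.trans_source]; rfl
  have htgt : ∀ y, y ∈ (c.trans e).target ↔ y ∈ e.target ∧ e.symm y ∈ c.target := fun y => by
    rw [OpenPartialHomeomorph.trans_target]; rfl
  refine ⟨c.trans e, (hsrc a).2 ⟨hac, hae⟩, fun x hx => ?_, fun x hx => ?_, ?_, ?_⟩
  · have := (heW ((hsrc x).1 hx).2).2
    rwa [mem_preimage, c.left_inv ((hsrc x).1 hx).1] at this
  · change (e (c x)).1 = h x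
    rw [hef, hf]
    simp [c.left_inv ((hsrc x).1 hx).1]
  · refine ContMDiffOn.comp (t := e.source) (g := e) ?_
      (hcc.mono fun x hx => ((hsrc x).1 hx).1) fun x hx => ((hsrc x).1 hx).2
    exact ((hfs.mono heW).congr fun x _ => hef x).contMDiffOn
  · exact hcc'.comp (hes.contMDiffOn.mono fun y hy => ((htgt y).1 hy).1)
      fun y hy => ((htgt y).1 hy).2

/-- A smooth map with injective derivative at a point has a smooth local left inverse there. -/
theorem exists_leftInverse_of_injective_mfderiv {E' : Type*} [NormedAddCommGroup E']
    [NormedSpace ℝ E'] [FiniteDimensional ℝ E'] {H' : Type*} [TopologicalSpace H']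
    {I' : ModelWithCorners ℝ E' H'} {N' : Type*} [TopologicalSpace N'] [ChartedSpace H' N']
    [IsManifold I' ∞ N'] {f : N → N'} (hf : ContMDiff I I' ∞ f) {a : N}
    (hi : Function.Injective (mfderiv I I' f a)) :
    ∃ r : N' → N, ContMDiffAt I' I ∞ r (f a) ∧ ∀ᶠ z in 𝓝 a, r (f z) = z := by
  let D : E →ₗ[ℝ] E' := (mfderiv I I' f a).toLinearMap
  -- A linear left inverse of the derivative, applied after a chart around `f a`, turns `f` into a
  -- local diffeomorphism: the derivative of the chart at its centre is the identity.
  obtain ⟨A, hA⟩ := LinearMap.exists_leftInverse_of_injective D (LinearMap.ker_eq_bot.2 hi)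
  let A' : E' →L[ℝ] E := LinearMap.toContinuousLinearMap A
  set U : Set N := f ⁻¹' (chartAt H' (f a)).source with hU
  have hUo : IsOpen U := (chartAt H' (f a)).open_source.preimage hf.continuous
  have hψ : ContMDiffOn I' 𝓘(ℝ, E) ∞ (fun y => A' (extChartAt I' (f a) y))
      (chartAt H' (f a)).source :=
    A'.contMDiff.comp_contMDiffOn contMDiffOn_extChartAt
  have hfa : MDifferentiableAt I I' f a := (hf a).mdifferentiableAt (by simp)
  have hk : ContMDiffOn I 𝓘(ℝ, E) ∞ (fun z => A' (extChartAt I' (f a) (f z))) U :=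
    hψ.comp hf.contMDiffOn fun x hx => hx
  have hs : Function.Surjective
      (mfderiv I 𝓘(ℝ, E) (fun z => A' (extChartAt I' (f a) (f z))) a) := by
    have h1 : HasMFDerivAt I 𝓘(ℝ, E) (fun z => A' (extChartAt I' (f a) (f z))) a _ :=
      (A'.hasMFDerivAt (x := extChartAt I' (f a) (f a))).comp a
        ((mdifferentiableAt_extChartAt (mem_chart_source H' (f a))).hasMFDerivAt.comp a
          hfa.hasMFDerivAt)
    rw [h1.mfderiv, mfderiv_extChartAt_self]
    intro v
    exact ⟨v, LinearMap.congr_fun hA v⟩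
  -- With a zero-dimensional complement, straightening is the inverse function theorem on a
  -- manifold.
  obtain ⟨Φ, haΦ, hΦU, hΦ, -, hΦs⟩ := exists_straightening (F := EuclideanSpace ℝ (Fin 0))
    hUo hk (mem_chart_source H' (f a)) hs (by simp)
  have key : ∀ z ∈ Φ.source,
      Φ z = (A' (extChartAt I' (f a) (f z)), (0 : EuclideanSpace ℝ (Fin 0))) :=
    fun z hz => Prod.ext (hΦ z hz) (Subsingleton.elim _ _)
  refine ⟨fun y => Φ.symm (A' (extChartAt I' (f a) y), 0), ?_, ?_⟩
  · refine ContMDiffAt.comp (f a) (g := Φ.symm) (I' := 𝓘(ℝ, E × EuclideanSpace ℝ (Fin 0))) ?_ ?_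
    · refine hΦs.contMDiffAt (Φ.open_target.mem_nhds ?_)
      rw [← key a haΦ]
      exact Φ.map_source haΦ
    · exact (hψ.contMDiffAt ((chartAt H' (f a)).open_source.mem_nhds
        (mem_chart_source H' (f a)))).prodMk_space contMDiffAt_const
  · filter_upwards [Φ.open_source.mem_nhds haΦ] with z hz
    rw [← key z hz, Φ.left_inv hz]

end InverseFunction

/-! ### Submersions -/

section Submersion

variable {m n : ℕ}
  {M : Type*} [TopologicalSpace M] [ChartedSpace (EuclideanSpace ℝ (Fin m)) M]
  {N : Type*} [TopologicalSpace N] [ChartedSpace (EuclideanSpace ℝ (Fin n)) N]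

/-- A smooth map of finite-dimensional manifolds with surjective derivatives is a submersion. -/
theorem isSubmersion_of_surjective_mfderiv [IsManifold (𝓡 m) ∞ M] [IsManifold (𝓡 n) ∞ N]
    {f : M → N} (hf : ContMDiff (𝓡 m) (𝓡 n) ∞ f)
    (hs : ∀ x, Function.Surjective (mfderiv (𝓡 m) (𝓡 n) f x)) :
    Manifold.IsSubmersion (𝓡 m) (𝓡 n) ∞ f := by
  -- One complement must serve all points. The truncated subtraction is harmless, since surjectivity
  -- of the derivative at any point forces `n ≤ m`.
  refine ⟨EuclideanSpace ℝ (Fin (m - n)), inferInstance, inferInstance, fun x => ?_⟩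
  have hmn : n ≤ m := by
    let D : EuclideanSpace ℝ (Fin m) →ₗ[ℝ] EuclideanSpace ℝ (Fin n) :=
      (mfderiv (𝓡 m) (𝓡 n) f x).toLinearMap
    simpa using LinearMap.finrank_le_finrank_of_surjective (f := D) (hs x)
  have hdim : Module.finrank ℝ (EuclideanSpace ℝ (Fin m)) =
      Module.finrank ℝ (EuclideanSpace ℝ (Fin n)) +
        Module.finrank ℝ (EuclideanSpace ℝ (Fin (m - n))) := by simp [hmn]
  let L : EuclideanSpace ℝ (Fin m) ≃L[ℝ]
      EuclideanSpace ℝ (Fin n) × EuclideanSpace ℝ (Fin (m - n)) :=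
    (LinearEquiv.ofFinrankEq _ _ (by simp [hmn])).toContinuousLinearEquiv
  set ψ := chartAt (EuclideanSpace ℝ (Fin n)) (f x) with hψ
  set U : Set M := f ⁻¹' ψ.source with hU
  have hUo : IsOpen U := ψ.open_source.preimage hf.continuous
  have hk : ContMDiffOn (𝓡 m) (𝓡 n) ∞ (fun z => extChartAt (𝓡 n) (f x) (f z)) U :=
    contMDiffOn_extChartAt.comp hf.contMDiffOn fun x hx => hx
  have hfx : MDifferentiableAt (𝓡 m) (𝓡 n) f x := (hf x).mdifferentiableAt (by simp)
  have hks : Function.Surjective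
      (mfderiv (𝓡 m) (𝓡 n) (fun z => extChartAt (𝓡 n) (f x) (f z)) x) := by
    have h1 : HasMFDerivAt (𝓡 m) (𝓡 n) (fun z => extChartAt (𝓡 n) (f x) (f z)) x _ :=
      (mdifferentiableAt_extChartAt (mem_chart_source _ (f x))).hasMFDerivAt.comp x hfx.hasMFDerivAt
    rw [h1.mfderiv, mfderiv_extChartAt_self]
    exact hs x
  obtain ⟨Φ, hxΦ, hΦU, hΦ, hΦd, hΦs⟩ := exists_straightening hUo hk (mem_chart_source _ (f x))
    hks hdim
  have hL : ContMDiff 𝓘(ℝ, _) 𝓘(ℝ, _) ∞ L.symm := L.symm.contDiff.contMDiff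
  have hL' : ContMDiff 𝓘(ℝ, _) 𝓘(ℝ, _) ∞ L := L.contDiff.contMDiff
  -- The straightening, moved into the model space by `L.symm`, is a chart in which `f` is a linear
  -- projection.
  set e : OpenPartialHomeomorph M (EuclideanSpace ℝ (Fin m)) :=
    Φ.trans L.symm.toHomeomorph.toOpenPartialHomeomorph with he
  have hes : e.source = Φ.source := by simp [he]
  have het : e.target = L ⁻¹' Φ.target := by ext; simp [he]
  refine Manifold.IsSubmersionAtOfComplement.mk_of_charts L e ψ (by rwa [hes])
    (mem_chart_source _ _) ?_ (IsManifold.chart_mem_maximalAtlas _) (by rwa [hes]) ?_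
  · refine e.mem_maximalAtlas_of_contMDiffOn ?_ ?_
    · rw [hes]
      exact hL.comp_contMDiffOn hΦd
    · rw [het]
      exact hΦs.comp hL'.contMDiffOn fun x hx => hx
  · intro y hy
    have hy' : L y ∈ Φ.target := by
      have : y ∈ e.target := by simpa using hy
      rwa [het] at this
    have h1 := hΦ (Φ.symm (L y)) (Φ.map_target hy')
    rw [Φ.right_inv hy'] at h1
    exact h1.symm

/-- A submersion has smooth local sections. -/
theorem Manifold.IsSubmersion.exists_localSection [IsManifold (𝓡 m) ∞ M]
    {f : M → N} (hf : Manifold.IsSubmersion (𝓡 m) (𝓡 n) ∞ f) (x : M) :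
    ∃ (U : Set N) (σ : N → M), IsOpen U ∧ f x ∈ U ∧ ContMDiffOn (𝓡 n) (𝓡 m) ∞ σ U ∧
      σ (f x) = x ∧ ∀ y ∈ U, f (σ y) = y := by
  have h := hf.isSubmersionAt x
  set L := h.equiv
  set φ := h.domChart with hφ
  set ψ := h.codChart with hψ
  have hw : ∀ u ∈ φ.target, ψ (f (φ.symm u)) = (L u).1 := fun u hu =>
    h.writtenInCharts (by simpa using hu)
  have hx : x ∈ φ.source := h.mem_domChart_source
  have hfx : f x ∈ ψ.source := h.mem_codChart_source
  -- The section keeps the complementary coordinate frozen at its value at `x`.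
  set κ : N → EuclideanSpace ℝ (Fin m) := fun y => L.symm (ψ y, (L (φ x)).2) with hκ
  have hψs : ContMDiffOn (𝓡 n) (𝓡 n) ∞ ψ ψ.source :=
    contMDiffOn_of_mem_maximalAtlas h.codChart_mem_maximalAtlas
  have hκs : ContMDiffOn (𝓡 n) (𝓡 m) ∞ κ ψ.source :=
    L.symm.contDiff.contMDiff.comp_contMDiffOn (hψs.prodMk_space contMDiffOn_const)
  have hκx : κ (f x) = φ x := by
    have := hw (φ x) (φ.map_source hx)
    rw [φ.left_inv hx] at this
    rw [hκ]
    simp [this]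
  refine ⟨ψ.source ∩ κ ⁻¹' φ.target, φ.symm ∘ κ,
    hκs.continuousOn.isOpen_inter_preimage ψ.open_source φ.open_target,
    ⟨hfx, by rw [mem_preimage, hκx]; exact φ.map_source hx⟩, ?_, ?_, ?_⟩
  · exact (contMDiffOn_symm_of_mem_maximalAtlas h.domChart_mem_maximalAtlas).comp
      (hκs.mono inter_subset_left) fun y hy => hy.2
  · simp [hκx, φ.left_inv hx]
  · intro y hy
    have h1 := hw (κ y) hy.2
    have h2 : f (φ.symm (κ y)) ∈ ψ.source :=
      h.source_subset_preimage_source (φ.map_target hy.2)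
    refine ψ.injOn h2 hy.1 (h1.trans ?_)
    simp [hκ]

/-- A differentiable map with a differentiable local section through `x` has surjective
derivative at `x`. -/
theorem surjective_mfderiv_of_localSection {E : Type*} [NormedAddCommGroup E] [NormedSpace ℝ E]
    {H : Type*} [TopologicalSpace H] {I : ModelWithCorners ℝ E H}
    {E' : Type*} [NormedAddCommGroup E'] [NormedSpace ℝ E']
    {H' : Type*} [TopologicalSpace H'] {I' : ModelWithCorners ℝ E' H'}
    {M N : Type*} [TopologicalSpace M] [ChartedSpace H M] [TopologicalSpace N] [ChartedSpace H' N]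
    {f : M → N} {σ : N → M} {x : M} (hf : MDifferentiableAt I I' f x)
    (hσ : MDifferentiableAt I' I σ (f x)) (hx : σ (f x) = x) (h : ∀ᶠ y in 𝓝 (f x), f (σ y) = y) :
    Function.Surjective (mfderiv I I' f x) := by
  intro v
  -- Naming the base point `y` lets `x` be replaced by `σ y`, so that the chain rule applies to `f ∘
  -- σ` at `y` without transport between tangent spaces.
  obtain ⟨y, hy⟩ : ∃ y, y = f x := ⟨_, rfl⟩
  rw [← hy] at hσ hx h
  subst hx
  have h1 : HasMFDerivAt I' I' (f ∘ σ) y _ := hf.hasMFDerivAt.comp y hσ.hasMFDerivAt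
  have h2 : HasMFDerivAt I' I' (f ∘ σ) y (ContinuousLinearMap.id ℝ E') :=
    (hasMFDerivAt_id y).congr_of_eventuallyEq h
  exact ⟨mfderiv I' I σ y v, DFunLike.congr_fun (hasMFDerivAt_unique h1 h2) v⟩

/-- A smooth local section through `x` gives a right inverse of the derivative by the chain rule. -/
theorem Manifold.IsSubmersion.surjective_mfderiv [IsManifold (𝓡 m) ∞ M]
    {f : M → N} (hf : Manifold.IsSubmersion (𝓡 m) (𝓡 n) ∞ f) (x : M) :
    Function.Surjective (mfderiv (𝓡 m) (𝓡 n) f x) := by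
  obtain ⟨U, σ, hU, hxU, hσ, hx, h⟩ := hf.exists_localSection x
  exact surjective_mfderiv_of_localSection ((hf.contMDiff x).mdifferentiableAt (by simp))
    ((hσ.contMDiffAt (hU.mem_nhds hxU)).mdifferentiableAt (by simp)) hx
    (Filter.eventually_of_mem (hU.mem_nhds hxU) h)

end Submersion

/-! ### Derivatives as maps between the model spaces -/

section ModelDerivative

variable
  {E : Type*} [NormedAddCommGroup E] [NormedSpace ℝ E] {H : Type*} [TopologicalSpace H]
  {E' : Type*} [NormedAddCommGroup E'] [NormedSpace ℝ E'] {H' : Type*} [TopologicalSpace H']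
  {E'' : Type*} [NormedAddCommGroup E''] [NormedSpace ℝ E''] {H'' : Type*} [TopologicalSpace H'']
  {F : Type*} [NormedAddCommGroup F] [NormedSpace ℝ F] {K : Type*} [TopologicalSpace K]
  (I : ModelWithCorners ℝ E H) (I' : ModelWithCorners ℝ E' H') (I'' : ModelWithCorners ℝ E'' H'')
  (J : ModelWithCorners ℝ F K)
  {M M' M'' N : Type*} [TopologicalSpace M] [ChartedSpace H M] [TopologicalSpace M']
  [ChartedSpace H' M'] [TopologicalSpace M''] [ChartedSpace H'' M'']
  [TopologicalSpace N] [ChartedSpace K N]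

/-- The derivative of a map of manifolds, as a map between the model spaces, so that its type does
not depend on the point. -/
noncomputable def modelDeriv (f : M → M') (x : M) : E →L[ℝ] E' := mfderiv I I' f x

variable {I I' I'' J}

theorem modelDeriv_comp {g : M' → M''} {f : M → M'} {x : M} (hg : MDifferentiableAt I' I'' g (f x))
    (hf : MDifferentiableAt I I' f x) (v : E) :
    modelDeriv I I'' (fun z => g (f z)) x v = modelDeriv I' I'' g (f x) (modelDeriv I I' f x v) :=
  DFunLike.congr_fun (mfderiv_comp x hg hf) v

theorem modelDeriv_id {x : M} (v : E) : modelDeriv I I (fun z : M => z) x v = v :=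
  DFunLike.congr_fun (mfderiv_id (I := I) (x := x)) v

theorem modelDeriv_congr {f g : M → M'} {x : M} (h : f =ᶠ[𝓝 x] g) :
    modelDeriv I I' f x = modelDeriv I I' g x :=
  Filter.EventuallyEq.mfderiv_eq h

theorem modelDeriv_prodMk {f : M → M'} {g : M → M''} {x : M} (hf : MDifferentiableAt I I' f x)
    (hg : MDifferentiableAt I I'' g x) (v : E) :
    modelDeriv I (I'.prod I'') (fun z => (f z, g z)) x v =
      (modelDeriv I I' f x v, modelDeriv I I'' g x v) :=
  DFunLike.congr_fun (mfderiv_prodMk hf hg) v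

theorem modelDeriv_prodMap {f : M → M'} {g : N → M''} {x : M × N}
    (hf : MDifferentiableAt I I' f x.1) (hg : MDifferentiableAt J I'' g x.2) (v : E × F) :
    modelDeriv (I.prod J) (I'.prod I'') (Prod.map f g) x v =
      (modelDeriv I I' f x.1 v.1, modelDeriv J I'' g x.2 v.2) :=
  DFunLike.congr_fun (mfderiv_prodMap hf hg) v

theorem injective_modelDeriv_of_leftInverse {f : M → M'} {r : M' → M} {x : M}
    (hf : MDifferentiableAt I I' f x) (hr : MDifferentiableAt I' I r (f x))
    (h : ∀ᶠ z in 𝓝 x, r (f z) = z) : Function.Injective (modelDeriv I I' f x) := by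
  refine Function.LeftInverse.injective (g := modelDeriv I' I r (f x)) fun v => ?_
  rw [← modelDeriv_comp hr hf, modelDeriv_congr h, modelDeriv_id]

end ModelDerivative

/-! ### Smooth structures on subspaces of manifolds -/

section Submanifold

variable {n : ℕ}
  {E : Type*} [NormedAddCommGroup E] [NormedSpace ℝ E] {H : Type*} [TopologicalSpace H]
  {I : ModelWithCorners ℝ E H}
  {P : Type*} [TopologicalSpace P] {N : Type*} [TopologicalSpace N] [ChartedSpace H N]

variable (I) in
/-- A chart of `P` that is compatible with the smooth structure of `N` via `ι : P → N`: its inverse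
is smooth as a map to `N`, and it extends to a smooth map on an open subset of `N`. -/
def IsSubmanifoldChart (ι : P → N) (e : OpenPartialHomeomorph P (EuclideanSpace ℝ (Fin n))) :
    Prop :=
  ContMDiffOn (𝓡 n) I ∞ (ι ∘ e.symm) e.target ∧
    ∃ (Ω : Set N) (r : N → EuclideanSpace ℝ (Fin n)), IsOpen Ω ∧ ContMDiffOn I (𝓡 n) ∞ r Ω ∧
      ∀ z ∈ e.source, ι z ∈ Ω ∧ e z = r (ι z)

/-- If every point lies in a compatible chart, there is a smooth structure making the map to the
ambient manifold an immersion. -/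
theorem exists_isManifold_of_isSubmanifoldChart {ι : P → N}
    (h : ∀ z, ∃ e : OpenPartialHomeomorph P (EuclideanSpace ℝ (Fin n)),
      IsSubmanifoldChart I ι e ∧ z ∈ e.source) :
    ∃ (_ : ChartedSpace (EuclideanSpace ℝ (Fin n)) P) (_ : IsManifold (𝓡 n) ∞ P),
      ContMDiff (𝓡 n) I ∞ ι ∧ ∀ z, Function.Injective (modelDeriv (𝓡 n) I ι z) := by
  choose c hc hzc using h
  let cs : ChartedSpace (EuclideanSpace ℝ (Fin n)) P :=
    { atlas := {e | IsSubmanifoldChart I ι e}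
      chartAt := c
      mem_chart_source := hzc
      chart_mem_atlas := hc }
  have hm : IsManifold (𝓡 n) ∞ P := by
    -- The transition from `e` to `e'` is the inverse of `e` as a map to `N`, followed by the smooth
    -- extension `r` of `e'`; both are smooth.
    refine isManifold_of_contDiffOn _ _ _ fun e e' he he' => ?_
    obtain ⟨Ω, r, hΩ, hr, hre⟩ := he'.2
    have h1 : ContMDiffOn (𝓡 n) (𝓡 n) ∞ (r ∘ (ι ∘ e.symm)) (e.symm.trans e').source := by
      refine hr.comp (he.1.mono fun y hy => ?_) fun y hy => ?_
      · rw [OpenPartialHomeomorph.trans_source] at hy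
        exact hy.1
      · rw [OpenPartialHomeomorph.trans_source] at hy
        exact (hre _ hy.2).1
    have h2 := (h1.congr (f₁ := e' ∘ e.symm) fun y hy => by
      rw [OpenPartialHomeomorph.trans_source] at hy
      exact (hre _ hy.2).2).contDiffOn
    simpa using h2
  have hι : ContMDiff (𝓡 n) I ∞ ι := fun z => by
    have h1 : ContMDiffOn (𝓡 n) I ∞ ((ι ∘ (c z).symm) ∘ c z) (c z).source :=
      (hc z).1.comp (contMDiffOn_chart (I := 𝓡 n) (x := z)) fun y hy => (c z).map_source hy
    refine (h1.congr fun y hy => ?_).contMDiffAt ((c z).open_source.mem_nhds (hzc z))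
    simp [(c z).left_inv hy]
  refine ⟨cs, hm, hι, fun z => ?_⟩
  -- The extension of the chart, followed by the inverse chart, is a local left inverse of `ι`.
  obtain ⟨Ω, r, hΩ, hr, hre⟩ := (hc z).2
  have hrz : ContMDiffAt I (𝓡 n) ∞ r (ι z) := hr.contMDiffAt (hΩ.mem_nhds (hre z (hzc z)).1)
  have hsz : ContMDiffAt (𝓡 n) (𝓡 n) ∞ (c z).symm (r (ι z)) := by
    rw [← (hre z (hzc z)).2]
    exact (contMDiffOn_chart_symm (I := 𝓡 n) (x := z)).contMDiffAt
      ((c z).open_target.mem_nhds ((c z).map_source (hzc z)))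
  refine injective_modelDeriv_of_leftInverse (r := (c z).symm ∘ r)
    ((hι z).mdifferentiableAt (by simp))
    ((hsz.comp (ι z) hrz).mdifferentiableAt (by simp)) ?_
  filter_upwards [(c z).open_source.mem_nhds (hzc z)] with y hy
  rw [Function.comp_apply, ← (hre y hy).2, (c z).left_inv hy]

/-- A map into an embedded submanifold is smooth if it is smooth as a map to the ambient
manifold. -/
theorem contMDiffOn_of_comp_embedding
    {E₀ : Type*} [NormedAddCommGroup E₀] [NormedSpace ℝ E₀] [FiniteDimensional ℝ E₀]
    {H₀ : Type*} [TopologicalSpace H₀] {I₀ : ModelWithCorners ℝ E₀ H₀} [I₀.Boundaryless]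
    [ChartedSpace H₀ P] [IsManifold I₀ ∞ P] [FiniteDimensional ℝ E] [IsManifold I ∞ N]
    {ι : P → N} (hι : ContMDiff I₀ I ∞ ι) (hemb : IsEmbedding ι)
    (hinj : ∀ z, Function.Injective (modelDeriv I₀ I ι z))
    {E' : Type*} [NormedAddCommGroup E'] [NormedSpace ℝ E'] {H' : Type*} [TopologicalSpace H']
    {J : ModelWithCorners ℝ E' H'} {Z : Type*} [TopologicalSpace Z] [ChartedSpace H' Z]
    {c : Z → P} {S : Set Z} (hc : ContMDiffOn J I ∞ (fun z => ι (c z)) S) :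
    ContMDiffOn J I₀ ∞ c S := by
  intro z hz
  -- Continuity of `c`, which needs the embedding, keeps `c` inside the neighbourhood where `r`
  -- inverts `ι`; there `c` equals `r ∘ ι ∘ c`.
  have hcont : ContinuousWithinAt c S z :=
    hemb.isInducing.continuousWithinAt_iff.2 (hc.continuousOn z hz)
  obtain ⟨r, hr, hri⟩ := exists_leftInverse_of_injective_mfderiv hι (hinj (c z))
  refine (hr.comp_contMDiffWithinAt z (hc z hz)).congr_of_eventuallyEq ?_ ?_
  · filter_upwards [hcont.eventually hri] with y hy using hy.symm
  · exact hri.self_of_nhds.symm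

end Submanifold

/-! ### Good pullbacks -/

section GoodPullback

variable
  {EP : Type*} [NormedAddCommGroup EP] [NormedSpace ℝ EP] {HP : Type*} [TopologicalSpace HP]
  {EX : Type*} [NormedAddCommGroup EX] [NormedSpace ℝ EX] {HX : Type*} [TopologicalSpace HX]
  {EY : Type*} [NormedAddCommGroup EY] [NormedSpace ℝ EY] {HY : Type*} [TopologicalSpace HY]
  {EB : Type*} [NormedAddCommGroup EB] [NormedSpace ℝ EB] {HB : Type*} [TopologicalSpace HB]
  {IP : ModelWithCorners ℝ EP HP} {IX : ModelWithCorners ℝ EX HX}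
  {IY : ModelWithCorners ℝ EY HY} {IB : ModelWithCorners ℝ EB HB}
  {P X Y B : Type u}
  [TopologicalSpace P] [ChartedSpace HP P] [TopologicalSpace X] [ChartedSpace HX X]
  [TopologicalSpace Y] [ChartedSpace HY Y] [TopologicalSpace B] [ChartedSpace HB B]
  {p : P → X} {q : P → Y} {f : X → B} {g : Y → B}

namespace IsGoodPullback

theorem existsUnique_modelDeriv (h : IsGoodPullback IP IX IY IB p q f g) (z : P) {v : EX} {w : EY}
    (e : modelDeriv IX IB f (p z) v = modelDeriv IY IB g (q z) w) :
    ∃! t : EP, modelDeriv IP IX p z t = v ∧ modelDeriv IP IY q z t = w :=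
  h.tangent z v w e

/-- Uniqueness in the tangent pullback says that a tangent vector is determined by its two
components. -/
theorem injective_modelDeriv (h : IsGoodPullback IP IX IY IB p q f g) (z : P) :
    Function.Injective (modelDeriv IP (IX.prod IY) (fun z => (p z, q z)) z) := by
  intro t t' ht
  rw [modelDeriv_prodMk ((h.smooth_left z).mdifferentiableAt (by simp))
    ((h.smooth_right z).mdifferentiableAt (by simp)),
    modelDeriv_prodMk ((h.smooth_left z).mdifferentiableAt (by simp))
    ((h.smooth_right z).mdifferentiableAt (by simp))] at ht
  exact (h.existsUnique_modelDeriv z (h.tangent_comm z t')).unique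
    ⟨congrArg Prod.fst ht, congrArg Prod.snd ht⟩ ⟨rfl, rfl⟩

theorem eq_of_eq (h : IsGoodPullback IP IX IY IB p q f g) {z z' : P} (hp : p z = p z')
    (hq : q z = q z') : z = z' :=
  h.embedding.injective (Prod.ext hp hq)

theorem exists_of_eq (h : IsGoodPullback IP IX IY IB p q f g) {x : X} {y : Y} (e : f x = g y) :
    ∃ z, p z = x ∧ q z = y := by
  have : (x, y) ∈ range (fun z => (p z, q z)) := by rw [h.range_eq]; exact e
  obtain ⟨z, hz⟩ := this
  exact ⟨z, congrArg Prod.fst hz, congrArg Prod.snd hz⟩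

variable [FiniteDimensional ℝ EP] [FiniteDimensional ℝ EX] [FiniteDimensional ℝ EY]
  [IP.Boundaryless] [IsManifold IP ∞ P] [IsManifold IX ∞ X] [IsManifold IY ∞ Y]
  {E' : Type*} [NormedAddCommGroup E'] [NormedSpace ℝ E'] {H' : Type*} [TopologicalSpace H']
  {J : ModelWithCorners ℝ E' H'} {Z : Type*} [TopologicalSpace Z] [ChartedSpace H' Z]

/-- The pair `(p, q)` is an embedding with injective derivatives, so smoothness can be tested after
composing with it. Arbitrary sets `S` are allowed so that the statement applies on composable pairs
and on fibre products. -/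
theorem contMDiffOn (h : IsGoodPullback IP IX IY IB p q f g) {c : Z → P} {S : Set Z}
    (hp : ContMDiffOn J IX ∞ (fun z => p (c z)) S) (hq : ContMDiffOn J IY ∞ (fun z => q (c z)) S) :
    ContMDiffOn J IP ∞ c S :=
  contMDiffOn_of_comp_embedding (h.smooth_left.prodMk h.smooth_right) h.embedding
    h.injective_modelDeriv (hp.prodMk hq)

theorem contMDiff (h : IsGoodPullback IP IX IY IB p q f g) {c : Z → P}
    (hp : ContMDiff J IX ∞ fun z => p (c z)) (hq : ContMDiff J IY ∞ fun z => q (c z)) :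
    ContMDiff J IP ∞ c :=
  contMDiffOn_univ.1 (h.contMDiffOn hp.contMDiffOn hq.contMDiffOn)

/-- The universal property of a good pullback follows from the other conditions. -/
theorem of_embedding (hf : ContMDiff IX IB ∞ f) (hg : ContMDiff IY IB ∞ g)
    (hp : ContMDiff IP IX ∞ p) (hq : ContMDiff IP IY ∞ q)
    (hemb : IsEmbedding fun z => (p z, q z))
    (hrange : range (fun z => (p z, q z)) = {w : X × Y | f w.1 = g w.2})
    (htan : ∀ (z : P) (v : EX) (w : EY),
      modelDeriv IX IB f (p z) v = modelDeriv IY IB g (q z) w →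
      ∃! t : EP, modelDeriv IP IX p z t = v ∧ modelDeriv IP IY q z t = w) :
    IsGoodPullback IP IX IY IB p q f g := by
  have hcomm : ∀ z, f (p z) = g (q z) := fun z => by
    have : (p z, q z) ∈ range (fun z => (p z, q z)) := ⟨z, rfl⟩
    rwa [hrange] at this
  have hpd := fun z => (hp z).mdifferentiableAt (n := ∞) (by simp)
  have hqd := fun z => (hq z).mdifferentiableAt (n := ∞) (by simp)
  have htc : ∀ (z : P) (v : EP), modelDeriv IX IB f (p z) (modelDeriv IP IX p z v) =
      modelDeriv IY IB g (q z) (modelDeriv IP IY q z v) := fun z v => by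
    rw [← modelDeriv_comp ((hf _).mdifferentiableAt (by simp)) (hpd z),
      ← modelDeriv_comp ((hg _).mdifferentiableAt (by simp)) (hqd z)]
    exact congrArg (fun k => modelDeriv IP IB k z v) (funext hcomm)
  have hinj : ∀ z, Function.Injective (modelDeriv IP (IX.prod IY) (fun z => (p z, q z)) z) := by
    intro z t t' ht
    rw [modelDeriv_prodMk (hpd z) (hqd z), modelDeriv_prodMk (hpd z) (hqd z)] at ht
    exact (htan z _ _ (htc z t')).unique
      ⟨congrArg Prod.fst ht, congrArg Prod.snd ht⟩ ⟨rfl, rfl⟩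
  refine ⟨hp, hq, hcomm, ?_, hemb, hrange, htc, htan⟩
  intro n Z _ _ _ _ _ a b ha hb hab
  have hex : ∀ z, ∃ y, (p y, q y) = (a z, b z) := fun z => by
    have : (a z, b z) ∈ range (fun z => (p z, q z)) := by rw [hrange]; exact hab z
    exact this
  -- The set-theoretic lift exists by the range condition and is unique by injectivity; its
  -- smoothness is automatic for an embedding with injective derivatives.
  choose c hc using hex
  refine ⟨c, ⟨?_, fun z => congrArg Prod.fst (hc z), fun z => congrArg Prod.snd (hc z)⟩, ?_⟩
  · refine contMDiffOn_univ.1 (contMDiffOn_of_comp_embedding (hp.prodMk hq) hemb hinj ?_)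
    exact ((ha.prodMk hb).congr hc).contMDiffOn
  · rintro c' ⟨-, h1, h2⟩
    exact funext fun z => hemb.injective ((Prod.ext (h1 z) (h2 z)).trans (hc z).symm)

end IsGoodPullback

variable (IX IY IB) in
/-- `f` and `g` are transversal. -/
def IsTransversal (f : X → B) (g : Y → B) : Prop :=
  ∀ x y, f x = g y → ∀ b : EB, ∃ (v : EX) (w : EY),
    modelDeriv IX IB f x v - modelDeriv IY IB g y w = b

end GoodPullback

/-! ### Fibre products of transversal maps. -/

section TransversalPullback

variable
  {EX : Type*} [NormedAddCommGroup EX] [NormedSpace ℝ EX] {HX : Type*} [TopologicalSpace HX]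
  {EY : Type*} [NormedAddCommGroup EY] [NormedSpace ℝ EY] {HY : Type*} [TopologicalSpace HY]
  {EB : Type*} [NormedAddCommGroup EB] [NormedSpace ℝ EB] {HB : Type*} [TopologicalSpace HB]
  {IX : ModelWithCorners ℝ EX HX} {IY : ModelWithCorners ℝ EY HY} {IB : ModelWithCorners ℝ EB HB}
  {P X Y B : Type u}
  [TopologicalSpace P] [TopologicalSpace X] [ChartedSpace HX X]
  [TopologicalSpace Y] [ChartedSpace HY Y]
  [TopologicalSpace B] [ChartedSpace HB B] [IsManifold IB ∞ B]
  {p : P → X} {q : P → Y} {f : X → B} {g : Y → B}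

namespace IsTransversal

/-- The difference of `f` and `g` in a chart of the base is a submersion at points of the fibre
product. -/
theorem exists_localEquation (h : IsTransversal IX IY IB f g) (hf : ContMDiff IX IB ∞ f)
    (hg : ContMDiff IY IB ∞ g) {x₀ : X} {y₀ : Y} (e : f x₀ = g y₀) :
    ∃ (U : Set (X × Y)) (k : X × Y → EB), IsOpen U ∧ (x₀, y₀) ∈ U ∧
      ContMDiffOn (IX.prod IY) 𝓘(ℝ, EB) ∞ k U ∧
      Function.Surjective (mfderiv (IX.prod IY) 𝓘(ℝ, EB) k (x₀, y₀)) ∧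
      ∀ w ∈ U, k w = 0 ↔ f w.1 = g w.2 := by
  set χ := extChartAt IB (f x₀) with hχ
  set C := (chartAt HB (f x₀)).source with hC
  have hCo : IsOpen C := (chartAt HB (f x₀)).open_source
  have hCx : f x₀ ∈ C := mem_chart_source HB (f x₀)
  have hχs : ContMDiffOn IB 𝓘(ℝ, EB) ∞ χ C := contMDiffOn_extChartAt
  set U : Set (X × Y) := {w | f w.1 ∈ C ∧ g w.2 ∈ C} with hU
  have hUo : IsOpen U :=
    (hCo.preimage (hf.continuous.comp continuous_fst)).inter
      (hCo.preimage (hg.continuous.comp continuous_snd))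
  have hmem : (x₀, y₀) ∈ U := ⟨hCx, by rw [← e]; exact hCx⟩
  have h1 : ContMDiffOn (IX.prod IY) 𝓘(ℝ, EB) ∞ (fun w => χ (f w.1)) U :=
    hχs.comp (hf.comp contMDiff_fst).contMDiffOn fun w hw => hw.1
  have h2 : ContMDiffOn (IX.prod IY) 𝓘(ℝ, EB) ∞ (fun w => χ (g w.2)) U :=
    hχs.comp (hg.comp contMDiff_snd).contMDiffOn fun w hw => hw.2
  refine ⟨U, fun w => χ (f w.1) - χ (g w.2), hUo, hmem, h1.sub h2, ?_, fun w hw => ?_⟩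
  · intro b
    obtain ⟨v, w, hvw⟩ := h x₀ y₀ e b
    -- The chart has identity derivative at its centre. The point `z` is kept variable because the
    -- fact is needed both at `f x₀` and at `g y₀`.
    have hχd : ∀ z, z = f x₀ → MDifferentiableAt IB 𝓘(ℝ, EB) χ z ∧
        ∀ u, modelDeriv IB 𝓘(ℝ, EB) χ z u = u := by
      rintro z rfl
      exact ⟨mdifferentiableAt_extChartAt hCx, fun u =>
        DFunLike.congr_fun (mfderiv_extChartAt_self (I := IB) (x := f x₀)) u⟩
    have hfd : MDifferentiableAt IX IB f x₀ := (hf x₀).mdifferentiableAt (by simp)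
    have hgd : MDifferentiableAt IY IB g y₀ := (hg y₀).mdifferentiableAt (by simp)
    have hfd' : HasMFDerivAt (IX.prod IY) 𝓘(ℝ, EB) (fun w : X × Y => χ (f w.1)) (x₀, y₀) _ :=
      (hχd (f x₀) rfl).1.hasMFDerivAt.comp (x₀, y₀)
        (hfd.hasMFDerivAt.comp (x₀, y₀) (hasMFDerivAt_fst (x₀, y₀)))
    have hgd' : HasMFDerivAt (IX.prod IY) 𝓘(ℝ, EB) (fun w : X × Y => χ (g w.2)) (x₀, y₀) _ :=
      (hχd (g y₀) e.symm).1.hasMFDerivAt.comp (x₀, y₀)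
        (hgd.hasMFDerivAt.comp (x₀, y₀) (hasMFDerivAt_snd (x₀, y₀)))
    have hd : HasMFDerivAt (IX.prod IY) 𝓘(ℝ, EB) (fun w : X × Y => χ (f w.1) - χ (g w.2))
      (x₀, y₀) _ := hfd'.sub hgd'
    rw [hd.mfderiv]
    refine ⟨(v, w), ?_⟩
    change modelDeriv IB 𝓘(ℝ, EB) χ (f x₀) (modelDeriv IX IB f x₀ v) -
      modelDeriv IB 𝓘(ℝ, EB) χ (g y₀) (modelDeriv IY IB g y₀ w) = b
    rw [(hχd _ rfl).2, (hχd _ e.symm).2, hvw]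
  · rw [sub_eq_zero]
    refine ⟨fun hk => χ.injOn ?_ ?_ hk, fun hk => by rw [hk]⟩
    · rw [hχ, extChartAt_source]; exact hw.1
    · rw [hχ, extChartAt_source]; exact hw.2

variable [FiniteDimensional ℝ EX] [FiniteDimensional ℝ EY] [FiniteDimensional ℝ EB]
  [IX.Boundaryless] [IY.Boundaryless] [IsManifold IX ∞ X] [IsManifold IY ∞ Y]

/-- Charts of a transversal fibre product. -/
theorem exists_isSubmanifoldChart (h : IsTransversal IX IY IB f g) (hf : ContMDiff IX IB ∞ f)
    (hg : ContMDiff IY IB ∞ g) (hemb : IsEmbedding fun z => (p z, q z))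
    (hrange : range (fun z => (p z, q z)) = {w : X × Y | f w.1 = g w.2}) {n : ℕ}
    (hn : Module.finrank ℝ EB + n = Module.finrank ℝ EX + Module.finrank ℝ EY) (z : P) :
    ∃ e : OpenPartialHomeomorph P (EuclideanSpace ℝ (Fin n)),
      IsSubmanifoldChart (IX.prod IY) (fun z => (p z, q z)) e ∧ z ∈ e.source := by
  have : Nonempty P := ⟨z⟩
  set ι : P → X × Y := fun z => (p z, q z) with hι
  have hιr : ∀ z, f (ι z).1 = g (ι z).2 := fun z => by
    have : ι z ∈ range ι := ⟨z, rfl⟩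
    rwa [hrange] at this
  obtain ⟨U, k, hU, hzU, hk, hks, hk0⟩ := h.exists_localEquation hf hg (hιr z)
  -- In the straightened coordinates the fibre product is the slice where the `EB`-coordinate
  -- vanishes; the other coordinate is the chart of `P`.
  obtain ⟨Φ, hzΦ, hΦU, hΦ, hΦd, hΦs⟩ := exists_straightening
    (F := EuclideanSpace ℝ (Fin n)) hU hk hzU hks (by simp [hn])
  have key : ∀ y ∈ ι ⁻¹' Φ.source, ((0 : EB), (Φ (ι y)).2) = Φ (ι y) := fun y hy =>
    Prod.ext (((hΦ _ hy).trans ((hk0 _ (hΦU hy)).2 (hιr y))).symm) rfl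
  have hinv : ∀ u, ((0 : EB), u) ∈ Φ.target →
      ι (Function.invFun ι (Φ.symm (0, u))) = Φ.symm (0, u) := fun u hu => by
    refine Function.invFun_eq ?_
    have hs := Φ.map_target hu
    have : Φ.symm (0, u) ∈ range ι := by
      rw [hrange]
      refine (hk0 _ (hΦU hs)).1 ?_
      rw [← hΦ _ hs, Φ.right_inv hu]
    exact this
  have hslice : ContMDiff (𝓡 n) 𝓘(ℝ, EB × EuclideanSpace ℝ (Fin n)) ∞
      (fun u : EuclideanSpace ℝ (Fin n) => ((0 : EB), u)) :=
    contMDiff_const.prodMk_space contMDiff_id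
  have hΦs' : ContMDiffOn (𝓡 n) (IX.prod IY) ∞
      (fun u : EuclideanSpace ℝ (Fin n) => Φ.symm ((0 : EB), u)) {u | ((0 : EB), u) ∈ Φ.target} :=
    hΦs.comp hslice.contMDiffOn fun u hu => hu
  have hΦd' : ContMDiffOn (IX.prod IY) (𝓡 n) ∞ (fun w => (Φ w).2) Φ.source :=
    (ContinuousLinearMap.snd ℝ EB (EuclideanSpace ℝ (Fin n))).contMDiff.comp_contMDiffOn hΦd
  refine ⟨{
    toFun := fun y => (Φ (ι y)).2
    invFun := fun u => Function.invFun ι (Φ.symm (0, u))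
    source := ι ⁻¹' Φ.source
    target := {u | ((0 : EB), u) ∈ Φ.target}
    map_source' := fun y hy => by
      rw [mem_ofPred_eq, key y hy]
      exact Φ.map_source hy
    map_target' := fun u hu => by
      rw [mem_preimage, hinv u hu]
      exact Φ.map_target hu
    left_inv' := fun y hy => hemb.injective <| by
      have h1 : ((0 : EB), (Φ (ι y)).2) ∈ Φ.target := by
        rw [key y hy]
        exact Φ.map_source hy
      exact (hinv _ h1).trans (by rw [key y hy, Φ.left_inv hy])
    right_inv' := fun u hu => by rw [hinv u hu, Φ.right_inv hu]
    open_source := Φ.open_source.preimage hemb.continuous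
    open_target := Φ.open_target.preimage hslice.continuous
    continuousOn_toFun := hΦd'.continuousOn.comp hemb.continuous.continuousOn fun y hy => hy
    continuousOn_invFun :=
      hemb.isInducing.continuousOn_iff.2 (hΦs'.continuousOn.congr hinv) }, ⟨?_, ?_⟩, hzΦ⟩
  · exact hΦs'.congr hinv
  · exact ⟨Φ.source, fun w => (Φ w).2, Φ.open_source, hΦd', fun y hy => ⟨hy, rfl⟩⟩

/-- The fibre product of transversal maps is a good pullback. -/
theorem exists_isGoodPullback (h : IsTransversal IX IY IB f g) (hf : ContMDiff IX IB ∞ f)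
    (hg : ContMDiff IY IB ∞ g) (hemb : IsEmbedding fun z => (p z, q z))
    (hrange : range (fun z => (p z, q z)) = {w : X × Y | f w.1 = g w.2}) :
    ∃ (n : ℕ) (_ : ChartedSpace (EuclideanSpace ℝ (Fin n)) P) (_ : IsManifold (𝓡 n) ∞ P),
      IsGoodPullback (𝓡 n) IX IY IB p q f g := by
  -- The subtraction is exact whenever `P` has a point, since transversality makes `D z` surjective;
  -- for empty `P` the value of `n` is irrelevant.
  set n := Module.finrank ℝ EX + Module.finrank ℝ EY - Module.finrank ℝ EB with hn
  have hcomm : ∀ z, f (p z) = g (q z) := fun z => by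
    have : (p z, q z) ∈ range (fun z => (p z, q z)) := ⟨z, rfl⟩
    rwa [hrange] at this
  let D : P → (EX × EY →L[ℝ] EB) := fun z =>
    (modelDeriv IX IB f (p z)).comp (ContinuousLinearMap.fst ℝ EX EY) -
      (modelDeriv IY IB g (q z)).comp (ContinuousLinearMap.snd ℝ EX EY)
  have hD : ∀ z, Function.Surjective (D z).toLinearMap := fun z b => by
    obtain ⟨v, w, hvw⟩ := h (p z) (q z) (hcomm z) b
    exact ⟨(v, w), hvw⟩
  have hdim : ∀ z : P, Module.finrank ℝ EB + n = Module.finrank ℝ EX + Module.finrank ℝ EY :=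
    fun z => by
      have := LinearMap.finrank_le_finrank_of_surjective (hD z)
      rw [Module.finrank_prod] at this
      omega
  obtain ⟨cs, hm, hι, hinj⟩ := exists_isManifold_of_isSubmanifoldChart fun z =>
    h.exists_isSubmanifoldChart hf hg hemb hrange (hdim z) z
  have hp : ContMDiff (𝓡 n) IX ∞ p := hι.fst
  have hq : ContMDiff (𝓡 n) IY ∞ q := hι.snd
  refine ⟨n, cs, hm, IsGoodPullback.of_embedding hf hg hp hq hemb hrange fun z v w hvw => ?_⟩
  have hpd : MDifferentiableAt (𝓡 n) IX p z := (hp z).mdifferentiableAt (by simp)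
  have hqd : MDifferentiableAt (𝓡 n) IY q z := (hq z).mdifferentiableAt (by simp)
  let T : EuclideanSpace ℝ (Fin n) →ₗ[ℝ] EX × EY :=
    (modelDeriv (𝓡 n) (IX.prod IY) (fun z => (p z, q z)) z).toLinearMap
  have hT : ∀ t, T t = (modelDeriv (𝓡 n) IX p z t, modelDeriv (𝓡 n) IY q z t) :=
    modelDeriv_prodMk hpd hqd
  have hTi : Function.Injective T := hinj z
  -- One inclusion is the chain rule; equality follows by counting dimensions, both sides having
  -- dimension `n`.
  have hrk : LinearMap.range T = LinearMap.ker (D z).toLinearMap := by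
    refine Submodule.eq_of_le_of_finrank_eq ?_ ?_
    · rintro _ ⟨t, rfl⟩
      rw [LinearMap.mem_ker, hT]
      change modelDeriv IX IB f (p z) (modelDeriv (𝓡 n) IX p z t) -
        modelDeriv IY IB g (q z) (modelDeriv (𝓡 n) IY q z t) = 0
      rw [sub_eq_zero, ← modelDeriv_comp ((hf _).mdifferentiableAt (by simp)) hpd,
        ← modelDeriv_comp ((hg _).mdifferentiableAt (by simp)) hqd]
      exact congrArg (fun k => modelDeriv (𝓡 n) IB k z t) (funext hcomm)
    · have h1 := LinearMap.finrank_range_add_finrank_ker (D z).toLinearMap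
      rw [LinearMap.range_eq_top.2 (hD z), finrank_top, Module.finrank_prod] at h1
      have h2 := hdim z
      rw [LinearMap.finrank_range_of_inj hTi, finrank_euclideanSpace_fin]
      omega
  have hmem : (v, w) ∈ LinearMap.range T := by
    rw [hrk, LinearMap.mem_ker]
    exact sub_eq_zero.2 hvw
  obtain ⟨t, ht⟩ := hmem
  rw [hT] at ht
  refine ⟨t, ⟨congrArg Prod.fst ht, congrArg Prod.snd ht⟩, fun t' ht' => hTi ?_⟩
  rw [hT, hT, ht, ht'.1, ht'.2]

/-- A manifold with a bijection onto a transversal fibre product that is smooth in both directions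
is a good pullback. -/
theorem isGoodPullback_of_inverse (h : IsTransversal IX IY IB f g) (hf : ContMDiff IX IB ∞ f)
    (hg : ContMDiff IY IB ∞ g)
    {EP : Type*} [NormedAddCommGroup EP] [NormedSpace ℝ EP] [FiniteDimensional ℝ EP]
    {HP : Type*} [TopologicalSpace HP] {IP : ModelWithCorners ℝ EP HP} [IP.Boundaryless]
    [ChartedSpace HP P] [IsManifold IP ∞ P]
    (hp : ContMDiff IP IX ∞ p) (hq : ContMDiff IP IY ∞ q) (hcomm : ∀ z, f (p z) = g (q z))
    {θ : X × Y → P} (hθ : ContMDiffOn (IX.prod IY) IP ∞ θ {w | f w.1 = g w.2})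
    (hleft : ∀ z, θ (p z, q z) = z)
    (hright₁ : ∀ w : X × Y, f w.1 = g w.2 → p (θ w) = w.1)
    (hright₂ : ∀ w : X × Y, f w.1 = g w.2 → q (θ w) = w.2) :
    IsGoodPullback IP IX IY IB p q f g := by
  -- The fibre product itself is a good pullback, and `η` is a diffeomorphism onto it, so the
  -- tangent condition can be transported along the derivative of `η`.
  let W : Type u := {w : X × Y // f w.1 = g w.2}
  let η : P ≃ₜ W :=
    { toFun := fun z => ⟨(p z, q z), hcomm z⟩
      invFun := fun w => θ w.1
      left_inv := hleft
      right_inv := fun w => Subtype.ext (Prod.ext (hright₁ _ w.2) (hright₂ _ w.2))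
      continuous_toFun := (hp.continuous.prodMk hq.continuous).subtype_mk _
      continuous_invFun := continuousOn_iff_continuous_domRestrict.1 hθ.continuousOn }
  have hrange : range (fun z => (p z, q z)) = {w : X × Y | f w.1 = g w.2} := by
    refine Subset.antisymm ?_ fun w hw =>
      ⟨θ w, Prod.ext (hright₁ _ hw) (hright₂ _ hw)⟩
    rintro _ ⟨z, rfl⟩
    exact hcomm z
  obtain ⟨n, cs, hm, hW⟩ := h.exists_isGoodPullback (P := W) (p := fun w => w.1.1)
    (q := fun w => w.1.2) hf hg IsEmbedding.subtypeVal Subtype.range_coe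
  have hηs : ContMDiff IP (𝓡 n) ∞ η := hW.contMDiff hp hq
  have hθs : ContMDiff (𝓡 n) IP ∞ η.symm :=
    contMDiffOn_univ.1 (hθ.comp (hW.smooth_left.prodMk hW.smooth_right).contMDiffOn
      fun w _ => w.2)
  refine IsGoodPullback.of_embedding hf hg hp hq
    (IsEmbedding.subtypeVal.comp η.isEmbedding) hrange fun z v w hvw => ?_
  have hηd : MDifferentiableAt IP (𝓡 n) η z := (hηs z).mdifferentiableAt (by simp)
  have hpη : ∀ t, modelDeriv IP IX p z t =
      modelDeriv (𝓡 n) IX (fun w : W => w.1.1) (η z) (modelDeriv IP (𝓡 n) η z t) :=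
    modelDeriv_comp ((hW.smooth_left _).mdifferentiableAt (by simp)) hηd
  have hqη : ∀ t, modelDeriv IP IY q z t =
      modelDeriv (𝓡 n) IY (fun w : W => w.1.2) (η z) (modelDeriv IP (𝓡 n) η z t) :=
    modelDeriv_comp ((hW.smooth_right _).mdifferentiableAt (by simp)) hηd
  have hinj : Function.Injective (modelDeriv IP (𝓡 n) η z) :=
    injective_modelDeriv_of_leftInverse hηd ((hθs _).mdifferentiableAt (by simp))
      (Filter.Eventually.of_forall η.symm_apply_apply)
  have hsurj : Function.Surjective (modelDeriv IP (𝓡 n) η z) :=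
    surjective_mfderiv_of_localSection hηd ((hθs _).mdifferentiableAt (by simp))
      (η.symm_apply_apply z) (Filter.Eventually.of_forall η.apply_symm_apply)
  obtain ⟨t', ht', huniq⟩ := hW.existsUnique_modelDeriv (η z) hvw
  obtain ⟨t, rfl⟩ := hsurj t'
  refine ⟨t, ⟨(hpη t).trans ht'.1, (hqη t).trans ht'.2⟩, fun s hs => hinj (huniq _ ?_)⟩
  exact ⟨(hpη s).symm.trans hs.1, (hqη s).symm.trans hs.2⟩

end IsTransversal

end TransversalPullback

/-! ### Criteria for transversality. -/

section Transversality

variable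
  {EX : Type*} [NormedAddCommGroup EX] [NormedSpace ℝ EX] {HX : Type*} [TopologicalSpace HX]
  {EY : Type*} [NormedAddCommGroup EY] [NormedSpace ℝ EY] {HY : Type*} [TopologicalSpace HY]
  {EB : Type*} [NormedAddCommGroup EB] [NormedSpace ℝ EB] {HB : Type*} [TopologicalSpace HB]
  {EZ : Type*} [NormedAddCommGroup EZ] [NormedSpace ℝ EZ] {HZ : Type*} [TopologicalSpace HZ]
  {IX : ModelWithCorners ℝ EX HX} {IY : ModelWithCorners ℝ EY HY} {IB : ModelWithCorners ℝ EB HB}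
  {IZ : ModelWithCorners ℝ EZ HZ} {X Y B Z : Type u}
  [TopologicalSpace X] [ChartedSpace HX X] [TopologicalSpace Y] [ChartedSpace HY Y]
  [TopologicalSpace B] [ChartedSpace HB B] [TopologicalSpace Z] [ChartedSpace HZ Z]
  {f : X → B} {g : Y → B}

/-- Transversality is preserved by composition with a map with surjective derivatives. -/
theorem IsTransversal.comp_left (h : IsTransversal IX IY IB f g) {π : Z → X}
    (hf : MDifferentiable IX IB f) (hπ : MDifferentiable IZ IX π)
    (hs : ∀ z, Function.Surjective (modelDeriv IZ IX π z)) :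
    IsTransversal IZ IY IB (fun z => f (π z)) g := by
  intro z y e b
  obtain ⟨v, w, hvw⟩ := h (π z) y e b
  obtain ⟨u, rfl⟩ := hs z v
  exact ⟨u, w, by rw [modelDeriv_comp (hf _) (hπ _), hvw]⟩

theorem IsTransversal.of_surjective_right
    (hs : ∀ y, Function.Surjective (modelDeriv IY IB g y)) :
    IsTransversal IX IY IB f g := by
  intro x y _ b
  obtain ⟨w, hw⟩ := hs y (-b)
  exact ⟨0, w, by rw [hw, map_zero]; abel⟩

theorem surjective_modelDeriv_prodMap {EW : Type*} [NormedAddCommGroup EW] [NormedSpace ℝ EW]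
    {HW : Type*} [TopologicalSpace HW] {IW : ModelWithCorners ℝ EW HW} {W : Type*}
    [TopologicalSpace W] [ChartedSpace HW W] {π : X → B} {π' : Z → W}
    (hπ : MDifferentiable IX IB π) (hπ' : MDifferentiable IZ IW π')
    (hs : ∀ x, Function.Surjective (modelDeriv IX IB π x))
    (hs' : ∀ z, Function.Surjective (modelDeriv IZ IW π' z)) (p : X × Z) :
    Function.Surjective (modelDeriv (IX.prod IZ) (IB.prod IW) (Prod.map π π') p) := by
  rintro ⟨b, b'⟩
  obtain ⟨v, hv⟩ := hs p.1 b
  obtain ⟨v', hv'⟩ := hs' p.2 b'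
  exact ⟨(v, v'), by rw [modelDeriv_prodMap (hπ _) (hπ' _), hv, hv']⟩

end Transversality

/-! ### Multiplication as a total function, and cancellation. -/

namespace GroupoidStr

variable {M G : Type u} (S : GroupoidStr M G)

open Classical in
/-- The multiplication, extended arbitrarily to pairs that are not composable. -/
noncomputable def mulTotal (g h : G) : G := if w : S.src g = S.tgt h then S.mul g h w else g

theorem mulTotal_eq {g h : G} (w : S.src g = S.tgt h) : S.mulTotal g h = S.mul g h w :=
  dif_pos w

theorem mul_right_cancel {g g' h : G} (w : S.src g = S.tgt h) (w' : S.src g' = S.tgt h)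
    (e : S.mul g h w = S.mul g' h w') : g = g' := by
  rw [← S.mul_inv_cancel_right g h w, S.mul_congr e rfl, S.mul_inv_cancel_right]

end GroupoidStr

/-! ### Smoothness and derivatives of the structural maps. -/

namespace LieGroupoid

section

variable (G : LieGroupoid.{u})

theorem contMDiff_src : ContMDiff (𝓡 G.dimAr) (𝓡 G.dimOb) ∞ G.str.src :=
  G.isLie.src_submersion.contMDiff

theorem contMDiff_tgt : ContMDiff (𝓡 G.dimAr) (𝓡 G.dimOb) ∞ G.str.tgt :=
  G.isLie.tgt_submersion.contMDiff

theorem contMDiff_anchor :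
    ContMDiff (𝓡 G.dimAr) ((𝓡 G.dimOb).prod (𝓡 G.dimOb)) ∞ G.str.anchor :=
  G.contMDiff_tgt.prodMk G.contMDiff_src

theorem mdifferentiable_src : MDifferentiable (𝓡 G.dimAr) (𝓡 G.dimOb) G.str.src :=
  G.contMDiff_src.mdifferentiable (by simp)

theorem mdifferentiable_tgt : MDifferentiable (𝓡 G.dimAr) (𝓡 G.dimOb) G.str.tgt :=
  G.contMDiff_tgt.mdifferentiable (by simp)

theorem surjective_modelDeriv_src (g : G.Ar) :
    Function.Surjective (modelDeriv (𝓡 G.dimAr) (𝓡 G.dimOb) G.str.src g) :=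
  G.isLie.src_submersion.surjective_mfderiv g

theorem surjective_modelDeriv_tgt (g : G.Ar) :
    Function.Surjective (modelDeriv (𝓡 G.dimAr) (𝓡 G.dimOb) G.str.tgt g) :=
  G.isLie.tgt_submersion.surjective_mfderiv g

theorem modelDeriv_anchor (g : G.Ar) (v : EuclideanSpace ℝ (Fin G.dimAr)) :
    modelDeriv (𝓡 G.dimAr) ((𝓡 G.dimOb).prod (𝓡 G.dimOb)) G.str.anchor g v =
      (modelDeriv (𝓡 G.dimAr) (𝓡 G.dimOb) G.str.tgt g v,
        modelDeriv (𝓡 G.dimAr) (𝓡 G.dimOb) G.str.src g v) :=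
  modelDeriv_prodMk (G.mdifferentiable_tgt g) (G.mdifferentiable_src g) v

variable {G} {E : Type*} [NormedAddCommGroup E] [NormedSpace ℝ E] {H : Type*} [TopologicalSpace H]
  {J : ModelWithCorners ℝ E H} {Z : Type*} [TopologicalSpace Z] [ChartedSpace H Z]

/-- Using the total multiplication removes the proof of composability from the function, so that
products of arrow-valued maps can be compared by congruence on `S`. -/
theorem contMDiffOn_mulTotal {a b : Z → G.Ar} {S : Set Z} (ha : ContMDiffOn J (𝓡 G.dimAr) ∞ a S)
    (hb : ContMDiffOn J (𝓡 G.dimAr) ∞ b S) (w : ∀ z ∈ S, G.str.src (a z) = G.str.tgt (b z)) :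
    ContMDiffOn J (𝓡 G.dimAr) ∞ (fun z => G.str.mulTotal (a z) (b z)) S := by
  obtain ⟨F, hF, hFm⟩ := G.isLie.smooth_mul
  refine (hF.comp (ha.prodMk hb) w).congr fun z hz => ?_
  rw [G.str.mulTotal_eq (w z hz)]
  exact (hFm _ _ _).symm

theorem contMDiff_mul {a b : Z → G.Ar} (ha : ContMDiff J (𝓡 G.dimAr) ∞ a)
    (hb : ContMDiff J (𝓡 G.dimAr) ∞ b) (w : ∀ z, G.str.src (a z) = G.str.tgt (b z)) :
    ContMDiff J (𝓡 G.dimAr) ∞ (fun z => G.str.mul (a z) (b z) (w z)) := by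
  refine contMDiffOn_univ.1 ((contMDiffOn_mulTotal ha.contMDiffOn hb.contMDiffOn
    fun z _ => w z).congr fun z _ => ?_)
  rw [G.str.mulTotal_eq (w z)]

end

/-- Infinitesimal form of essential surjectivity. -/
theorem Hom.IsEssentiallySurjective.exists_modelDeriv {A B : LieGroupoid.{u}} {φ : Hom A B}
    (h : φ.IsEssentiallySurjective) {g : B.Ar} {x : A.Ob} (e : B.str.tgt g = φ.ob x)
    (b : EuclideanSpace ℝ (Fin B.dimOb)) :
    ∃ (w : EuclideanSpace ℝ (Fin B.dimAr)) (v : EuclideanSpace ℝ (Fin A.dimOb)),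
      modelDeriv (𝓡 B.dimAr) (𝓡 B.dimOb) B.str.tgt g w =
        modelDeriv (𝓡 A.dimOb) (𝓡 B.dimOb) φ.ob x v ∧
      modelDeriv (𝓡 B.dimAr) (𝓡 B.dimOb) B.str.src g w = b := by
  obtain ⟨n, cs, hm, hpull, -, hsub⟩ := h
  -- Essential surjectivity concerns arrows starting at `φ.ob x`, whereas `g` ends there; inversion
  -- exchanges the roles of source and target.
  let z : φ.ArrowsFrom := ⟨(B.str.inv g, x), (B.str.src_inv g).trans e⟩
  obtain ⟨τ, hτ⟩ : ∃ τ : EuclideanSpace ℝ (Fin n), modelDeriv (𝓡 n) (𝓡 B.dimOb)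
      (fun p : φ.ArrowsFrom => B.str.tgt p.1.1) z τ = b := hsub.surjective_mfderiv z b
  rw [modelDeriv_comp (B.mdifferentiable_tgt _)
    ((hpull.smooth_left z).mdifferentiableAt (by simp))] at hτ
  have hc := hpull.tangent_comm z τ
  have hinv : MDifferentiable (𝓡 B.dimAr) (𝓡 B.dimAr) B.str.inv :=
    B.isLie.smooth_inv.mdifferentiable (by simp)
  obtain ⟨g', rfl⟩ : ∃ g', B.str.inv g' = g := ⟨B.str.inv g, B.str.inv_inv g⟩
  have hz : z.1.1 = g' := B.str.inv_inv g'
  refine ⟨modelDeriv (𝓡 B.dimAr) (𝓡 B.dimAr) B.str.inv g'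
    (modelDeriv (𝓡 n) (𝓡 B.dimAr) (fun p : φ.ArrowsFrom => p.1.1) z τ),
    modelDeriv (𝓡 n) (𝓡 A.dimOb) (fun p : φ.ArrowsFrom => p.1.2) z τ, ?_, ?_⟩
  · rw [← modelDeriv_comp (B.mdifferentiable_tgt _) (hinv _), funext B.str.tgt_inv, ← hz]
    exact hc
  · rw [← modelDeriv_comp (B.mdifferentiable_src _) (hinv _), funext B.str.src_inv, ← hz]
    exact hτ

/-! ### Transversality and existence of the homotopy pullback. -/

section HomotopyPullback

variable {G G₁ G₂ : LieGroupoid.{u}} {φ₁ : Hom G₁ G} {φ₂ : Hom G₂ G}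

/-- The vector `w₀` produces the first component because `t` is a submersion. A vector `w` from
essential surjectivity then corrects the second component, and its effect on the first is cancelled
by `dφ₁(v)`. No contribution from `φ₂` is needed. -/
theorem Hom.IsEssentiallySurjective.isTransversal (h : φ₁.IsEssentiallySurjective)
    (φ₂ : Hom G₂ G) :
    IsTransversal ((𝓡 G₁.dimOb).prod (𝓡 G₂.dimOb)) (𝓡 G.dimAr) ((𝓡 G.dimOb).prod (𝓡 G.dimOb))
      (Prod.map φ₁.ob φ₂.ob) G.str.anchor := by
  rintro ⟨x₁, x₂⟩ g e ⟨a, c⟩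
  obtain ⟨w₀, hw₀⟩ := G.surjective_modelDeriv_tgt g (-a)
  obtain ⟨w, v, hwv, hw⟩ := h.exists_modelDeriv (congrArg Prod.fst e).symm
    (-c - modelDeriv (𝓡 G.dimAr) (𝓡 G.dimOb) G.str.src g w₀)
  refine ⟨(v, 0), w₀ + w, ?_⟩
  rw [modelDeriv_prodMap ((φ₁.smooth_ob _).mdifferentiableAt (by simp))
    ((φ₂.smooth_ob _).mdifferentiableAt (by simp)), modelDeriv_anchor, map_add, map_add, hw₀, hw,
    hwv, map_zero]
  ext1
  · simp
  · simp

/-- By functoriality the left map is `s × t` followed by `φ₁ × φ₂` on objects, and `s × t` has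
surjective derivatives. -/
theorem Hom.IsEssentiallySurjective.isTransversal_arrows (h : φ₁.IsEssentiallySurjective)
    (φ₂ : Hom G₂ G) :
    IsTransversal ((𝓡 G₁.dimAr).prod (𝓡 G₂.dimAr)) (𝓡 G.dimAr) ((𝓡 G.dimOb).prod (𝓡 G.dimOb))
      (Prod.map (fun k₁ => G.str.src (φ₁.ar k₁)) (fun k₃ => G.str.tgt (φ₂.ar k₃)))
      G.str.anchor := by
  have h1 := (h.isTransversal φ₂).comp_left (π := Prod.map G₁.str.src G₂.str.tgt)
    ((φ₁.smooth_ob.prodMap φ₂.smooth_ob).mdifferentiable (by simp))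
    (G₁.mdifferentiable_src.prodMap G₂.mdifferentiable_tgt)
    (surjective_modelDeriv_prodMap G₁.mdifferentiable_src G₂.mdifferentiable_tgt
      G₁.surjective_modelDeriv_src G₂.surjective_modelDeriv_tgt)
  have h2 : Prod.map (fun k₁ => G.str.src (φ₁.ar k₁)) (fun k₃ => G.str.tgt (φ₂.ar k₃)) =
      fun z => Prod.map φ₁.ob φ₂.ob (Prod.map G₁.str.src G₂.str.tgt z) :=
    funext fun z => Prod.ext (φ₁.src_ar _) (φ₂.tgt_ar _)
  rwa [h2]

/-- The reordering of the factors of a triple product. -/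
def tripleHomeomorph (X Y Z : Type*) [TopologicalSpace X] [TopologicalSpace Y]
    [TopologicalSpace Z] : X × Y × Z ≃ₜ (X × Z) × Y where
  toFun p := ((p.1, p.2.2), p.2.1)
  invFun p := (p.1.1, p.2, p.1.2)
  left_inv _ := rfl
  right_inv _ := rfl
  continuous_toFun := by fun_prop
  continuous_invFun := by fun_prop

theorem isEmbedding_hpullOb :
    IsEmbedding fun p : HPullOb φ₁ φ₂ => ((p.1.1, p.1.2.2), p.1.2.1) :=
  (tripleHomeomorph _ _ _).isEmbedding.comp IsEmbedding.subtypeVal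

theorem isEmbedding_hpullAr :
    IsEmbedding fun k : HPullAr φ₁ φ₂ => ((k.1.1, k.1.2.2), k.1.2.1) :=
  (tripleHomeomorph _ _ _).isEmbedding.comp IsEmbedding.subtypeVal

theorem range_hpullOb :
    range (fun p : HPullOb φ₁ φ₂ => ((p.1.1, p.1.2.2), p.1.2.1)) =
      {w | Prod.map φ₁.ob φ₂.ob w.1 = G.str.anchor w.2} := by
  refine Subset.antisymm ?_ fun w hw => ?_
  · rintro _ ⟨p, rfl⟩
    exact Prod.ext p.2.1.symm p.2.2.symm
  · exact ⟨⟨(w.1.1, w.2, w.1.2), (congrArg Prod.fst hw).symm, (congrArg Prod.snd hw).symm⟩, rfl⟩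

theorem range_hpullAr :
    range (fun k : HPullAr φ₁ φ₂ => ((k.1.1, k.1.2.2), k.1.2.1)) =
      {w | Prod.map (fun k₁ => G.str.src (φ₁.ar k₁)) (fun k₃ => G.str.tgt (φ₂.ar k₃)) w.1 =
        G.str.anchor w.2} := by
  refine Subset.antisymm ?_ fun w hw => ?_
  · rintro _ ⟨p, rfl⟩
    exact Prod.ext p.2.1 p.2.2.symm
  · exact ⟨⟨(w.1.1, w.2, w.1.2), congrArg Prod.fst hw, (congrArg Prod.snd hw).symm⟩, rfl⟩

variable (φ₁ φ₂) in
/-- The smooth structure makes the objects of the homotopy pullback a good pullback. -/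
abbrev IsObjectPullback (d : ℕ) [ChartedSpace (EuclideanSpace ℝ (Fin d)) (HPullOb φ₁ φ₂)] : Prop :=
  IsGoodPullback (𝓡 d) ((𝓡 G₁.dimOb).prod (𝓡 G₂.dimOb)) (𝓡 G.dimAr)
    ((𝓡 G.dimOb).prod (𝓡 G.dimOb))
    (fun p : HPullOb φ₁ φ₂ => (p.1.1, p.1.2.2)) (fun p : HPullOb φ₁ φ₂ => p.1.2.1)
    (Prod.map φ₁.ob φ₂.ob) G.str.anchor

variable (φ₁ φ₂) in
/-- The smooth structure makes the arrows of the homotopy pullback a good pullback. -/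
abbrev IsArrowPullback (d : ℕ) [ChartedSpace (EuclideanSpace ℝ (Fin d)) (HPullAr φ₁ φ₂)] : Prop :=
  IsGoodPullback (𝓡 d) ((𝓡 G₁.dimAr).prod (𝓡 G₂.dimAr)) (𝓡 G.dimAr)
    ((𝓡 G.dimOb).prod (𝓡 G.dimOb))
    (fun k : HPullAr φ₁ φ₂ => (k.1.1, k.1.2.2)) (fun k : HPullAr φ₁ φ₂ => k.1.2.1)
    (Prod.map (fun k₁ => G.str.src (φ₁.ar k₁)) (fun k₃ => G.str.tgt (φ₂.ar k₃))) G.str.anchor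

/-! ### The Lie groupoid structure on the homotopy pullback. -/

section IsLie

variable {dO dA : ℕ}
  [ChartedSpace (EuclideanSpace ℝ (Fin dO)) (HPullOb φ₁ φ₂)]
  [ChartedSpace (EuclideanSpace ℝ (Fin dA)) (HPullAr φ₁ φ₂)]

theorem contMDiff_hpullSrc [IsManifold (𝓡 dO) ∞ (HPullOb φ₁ φ₂)]
    (hO : IsObjectPullback φ₁ φ₂ dO) (hA : IsArrowPullback φ₁ φ₂ dA) :
    ContMDiff (𝓡 dA) (𝓡 dO) ∞ (hpullSrc (φ₁ := φ₁) (φ₂ := φ₂)) :=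
  hO.contMDiff ((G₁.contMDiff_src.comp hA.smooth_left.fst).prodMk
    (G₂.contMDiff_src.comp hA.smooth_left.snd))
    (contMDiff_mul hA.smooth_right (φ₂.smooth_ar.comp hA.smooth_left.snd) fun k => k.2.2)

theorem contMDiff_hpullUnit [IsManifold (𝓡 dA) ∞ (HPullAr φ₁ φ₂)]
    (hO : IsObjectPullback φ₁ φ₂ dO) (hA : IsArrowPullback φ₁ φ₂ dA) :
    ContMDiff (𝓡 dO) (𝓡 dA) ∞ (hpullUnit (φ₁ := φ₁) (φ₂ := φ₂)) :=
  hA.contMDiff ((G₁.isLie.smooth_unit.comp hO.smooth_left.fst).prodMk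
    (G₂.isLie.smooth_unit.comp hO.smooth_left.snd)) hO.smooth_right

theorem contMDiff_hpullInv [IsManifold (𝓡 dA) ∞ (HPullAr φ₁ φ₂)]
    (hA : IsArrowPullback φ₁ φ₂ dA) :
    ContMDiff (𝓡 dA) (𝓡 dA) ∞ (hpullInv (φ₁ := φ₁) (φ₂ := φ₂)) :=
  hA.contMDiff ((G₁.isLie.smooth_inv.comp hA.smooth_left.fst).prodMk
    (G₂.isLie.smooth_inv.comp hA.smooth_left.snd))
    (contMDiff_mul (φ₁.smooth_ar.comp hA.smooth_left.fst)
      (contMDiff_mul hA.smooth_right (φ₂.smooth_ar.comp hA.smooth_left.snd) fun k => k.2.2)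
      hpull_inv_aux)

-- Each component of the product is a multiplication in `G₁`, `G` or `G₂`, smooth on composable
-- pairs; the value elsewhere plays no role.
open Classical in
theorem exists_contMDiffOn_hpullMul [IsManifold (𝓡 dA) ∞ (HPullAr φ₁ φ₂)]
    (hA : IsArrowPullback φ₁ φ₂ dA) :
    ∃ F : HPullAr φ₁ φ₂ × HPullAr φ₁ φ₂ → HPullAr φ₁ φ₂,
      ContMDiffOn ((𝓡 dA).prod (𝓡 dA)) (𝓡 dA) ∞ F {p | hpullSrc p.1 = hpullTgt p.2} ∧
        ∀ l k w, F (l, k) = hpullMul l k w := by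
  refine ⟨fun p => if w : hpullSrc p.1 = hpullTgt p.2 then hpullMul p.1 p.2 w else p.1, ?_,
    fun l k w => dif_pos w⟩
  have h₁ := hA.smooth_left.fst
  have h₃ := hA.smooth_left.snd
  refine hA.contMDiffOn (ContMDiffOn.prodMk ?_ ?_) ?_
  · refine (contMDiffOn_mulTotal (h₁.comp contMDiff_fst).contMDiffOn
      (h₁.comp contMDiff_snd).contMDiffOn fun p w => hpull_comp₁ w).congr fun p w => ?_
    rw [dif_pos (show hpullSrc p.1 = hpullTgt p.2 from w)]
    exact (G₁.str.mulTotal_eq _).symm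
  · refine (contMDiffOn_mulTotal (h₃.comp contMDiff_fst).contMDiffOn
      (h₃.comp contMDiff_snd).contMDiffOn fun p w => hpull_comp₃ w).congr fun p w => ?_
    rw [dif_pos (show hpullSrc p.1 = hpullTgt p.2 from w)]
    exact (G₂.str.mulTotal_eq _).symm
  · refine (contMDiffOn_mulTotal (hA.smooth_right.comp contMDiff_snd).contMDiffOn
      (G.isLie.smooth_inv.comp (φ₂.smooth_ar.comp (h₃.comp contMDiff_fst))).contMDiffOn
      fun p w => hpull_mid w).congr fun p w => ?_
    rw [dif_pos (show hpullSrc p.1 = hpullTgt p.2 from w)]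
    exact (G.str.mulTotal_eq _).symm

-- Local sections `σ₁`, `σ₃` of the sources of `G₁` and `G₂` choose the outer components of an arrow
-- with source `(x₁, g, x₂)`. The middle one is then forced to be `g φ₂(σ₃(x₂))⁻¹`, and this gives a
-- smooth local section through `k`.
open Classical in
theorem surjective_modelDeriv_hpullSrc [IsManifold (𝓡 dO) ∞ (HPullOb φ₁ φ₂)]
    [IsManifold (𝓡 dA) ∞ (HPullAr φ₁ φ₂)]
    (hO : IsObjectPullback φ₁ φ₂ dO) (hA : IsArrowPullback φ₁ φ₂ dA) (k : HPullAr φ₁ φ₂) :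
    Function.Surjective (modelDeriv (𝓡 dA) (𝓡 dO) hpullSrc k) := by
  obtain ⟨U₁, σ₁, hU₁, hkU₁, hσ₁, hσk₁, hσs₁⟩ := G₁.isLie.src_submersion.exists_localSection k.1.1
  obtain ⟨U₃, σ₃, hU₃, hkU₃, hσ₃, hσk₃, hσs₃⟩ :=
    G₂.isLie.src_submersion.exists_localSection k.1.2.2
  set U : Set (HPullOb φ₁ φ₂) := {p | p.1.1 ∈ U₁ ∧ p.1.2.2 ∈ U₃} with hU
  have hUo : IsOpen U := (hU₁.preimage hO.smooth_left.fst.continuous).inter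
    (hU₃.preimage hO.smooth_left.snd.continuous)
  have hkU : hpullSrc k ∈ U := ⟨hkU₁, hkU₃⟩
  have w : ∀ p ∈ U, G.str.src p.1.2.1 = G.str.src (φ₂.ar (σ₃ p.1.2.2)) := fun p hp => by
    rw [φ₂.src_ar, hσs₃ _ hp.2, p.2.2]
  have w' : ∀ p ∈ U, G.str.src p.1.2.1 = G.str.tgt (G.str.inv (φ₂.ar (σ₃ p.1.2.2))) :=
    fun p hp => by rw [G.str.tgt_inv, w p hp]
  let σ : HPullOb φ₁ φ₂ → HPullAr φ₁ φ₂ := fun p => if hp : p ∈ U then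
    ⟨(σ₁ p.1.1, G.str.mul p.1.2.1 (G.str.inv (φ₂.ar (σ₃ p.1.2.2))) (w' p hp), σ₃ p.1.2.2), by
      rw [φ₁.src_ar, hσs₁ _ hp.1, G.str.tgt_mul, p.2.1],
      by rw [G.str.src_mul, G.str.src_inv]⟩ else k
  have hσ : ContMDiffOn (𝓡 dO) (𝓡 dA) ∞ σ U := by
    have h₃ : ContMDiffOn (𝓡 dO) (𝓡 G₂.dimAr) ∞ (fun p : HPullOb φ₁ φ₂ => σ₃ p.1.2.2) U :=
      hσ₃.comp hO.smooth_left.snd.contMDiffOn fun p hp => hp.2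
    refine hA.contMDiffOn (ContMDiffOn.prodMk ?_ ?_) ?_
    · refine (hσ₁.comp hO.smooth_left.fst.contMDiffOn fun p hp => hp.1).congr fun p hp => ?_
      simp only [σ, dif_pos hp]
      rfl
    · refine h₃.congr fun p hp => ?_
      simp only [σ, dif_pos hp]
    · refine (contMDiffOn_mulTotal hO.smooth_right.contMDiffOn
        (G.isLie.smooth_inv.comp_contMDiffOn (φ₂.smooth_ar.comp_contMDiffOn h₃)) w').congr
        fun p hp => ?_
      simp only [σ, dif_pos hp]
      exact (G.str.mulTotal_eq _).symm
  have hsec : ∀ p ∈ U, hpullSrc (σ p) = p := fun p hp => by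
    simp only [σ, dif_pos hp]
    exact hpullOb_ext (hσs₁ _ hp.1) (G.str.inv_mul_cancel_right _ _ (w p hp)) (hσs₃ _ hp.2)
  have hσk : σ (hpullSrc k) = k := by
    simp only [σ, dif_pos hkU]
    refine hpullAr_ext hσk₁ ?_ hσk₃
    exact (G.str.mul_congr rfl (congrArg (fun l => G.str.inv (φ₂.ar l)) hσk₃) _).trans
      (G.str.mul_inv_cancel_right _ _ k.2.2)
  exact surjective_mfderiv_of_localSection
    ((contMDiff_hpullSrc hO hA k).mdifferentiableAt (by simp))
    ((hσ.contMDiffAt (hUo.mem_nhds hkU)).mdifferentiableAt (by simp)) hσk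
    (Filter.eventually_of_mem (hUo.mem_nhds hkU) hsec)

/-- A good pullback structure on objects and arrows makes the homotopy pullback a Lie groupoid. -/
theorem isLie_hpullStr [IsManifold (𝓡 dO) ∞ (HPullOb φ₁ φ₂)]
    [IsManifold (𝓡 dA) ∞ (HPullAr φ₁ φ₂)]
    (hO : IsObjectPullback φ₁ φ₂ dO) (hA : IsArrowPullback φ₁ φ₂ dA) :
    (hpullStr (φ₁ := φ₁) (φ₂ := φ₂)).IsLie dO dA := by
  have hs := contMDiff_hpullSrc hO hA
  have hi := contMDiff_hpullInv hA
  have hii : ∀ k : HPullAr φ₁ φ₂, hpullInv (hpullInv k) = k := hpullStr.inv_inv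
  -- Inversion is a smooth involution, so the claims for the target reduce to those for the source.
  have ht : (hpullTgt : HPullAr φ₁ φ₂ → HPullOb φ₁ φ₂) = fun k => hpullSrc (hpullInv k) :=
    funext fun k => (hpull_src_inv k).symm
  refine ⟨isSubmersion_of_surjective_mfderiv hs (surjective_modelDeriv_hpullSrc hO hA),
    isSubmersion_of_surjective_mfderiv (f := hpullTgt) (by rw [ht]; exact hs.comp hi)
      fun k => ?_, exists_contMDiffOn_hpullMul hA, contMDiff_hpullUnit hO hA, hi⟩
  change Function.Surjective (modelDeriv (𝓡 dA) (𝓡 dO) hpullTgt k)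
  rw [ht]
  have hik : MDifferentiableAt (𝓡 dA) (𝓡 dA) (hpullInv (φ₁ := φ₁) (φ₂ := φ₂)) k :=
    (hi k).mdifferentiableAt (by simp)
  intro v
  obtain ⟨u, rfl⟩ := surjective_modelDeriv_hpullSrc hO hA (hpullInv k) v
  obtain ⟨t, rfl⟩ : ∃ t, modelDeriv (𝓡 dA) (𝓡 dA) (hpullInv (φ₁ := φ₁) (φ₂ := φ₂)) k t = u :=
    surjective_mfderiv_of_localSection hik ((hi _).mdifferentiableAt (by simp)) (hii k)
      (Filter.Eventually.of_forall hii) u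
  exact ⟨t, modelDeriv_comp ((hs _).mdifferentiableAt (by simp)) hik t⟩

end IsLie

/-- The homotopy pullback along an essentially surjective map exists. -/
theorem Hom.IsEssentiallySurjective.nonempty_homotopyPullback (h : φ₁.IsEssentiallySurjective)
    (φ₂ : Hom G₂ G) : Nonempty (HomotopyPullback φ₁ φ₂) := by
  obtain ⟨dO, cO, mO, hO⟩ := (h.isTransversal φ₂).exists_isGoodPullback
    (φ₁.smooth_ob.prodMap φ₂.smooth_ob) G.contMDiff_anchor isEmbedding_hpullOb range_hpullOb
  obtain ⟨dA, cA, mA, hA⟩ := (h.isTransversal_arrows φ₂).exists_isGoodPullback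
    ((G.contMDiff_src.comp φ₁.smooth_ar).prodMap (G.contMDiff_tgt.comp φ₂.smooth_ar))
    G.contMDiff_anchor isEmbedding_hpullAr range_hpullAr
  exact ⟨⟨dO, dA, hO, hA, isLie_hpullStr hO hA⟩⟩

/-! ### The base-change is surjective and fully faithful. -/

section BaseChange

variable {dO dA : ℕ}
  [ChartedSpace (EuclideanSpace ℝ (Fin dO)) (HPullOb φ₁ φ₂)]
  [ChartedSpace (EuclideanSpace ℝ (Fin dA)) (HPullAr φ₁ φ₂)]

/-- Essential surjectivity gives an arrow from some `φ₁(x₁)` to `φ₂(x₂)`; its inverse is the middle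
component. -/
theorem Hom.IsEssentiallySurjective.surjective_hpullOb (h : φ₁.IsEssentiallySurjective)
    (φ₂ : Hom G₂ G) : Function.Surjective fun p : HPullOb φ₁ φ₂ => p.1.2.2 := by
  intro x₂
  obtain ⟨-, -, -, -, hs, -⟩ := h
  obtain ⟨⟨⟨g, x₁⟩, e⟩, hg⟩ := hs (φ₂.ob x₂)
  exact ⟨⟨(x₁, G.str.inv g, x₂), (G.str.tgt_inv g).trans e, (G.str.src_inv g).trans hg⟩, rfl⟩

/-- A lift of `v₂` is a triple `(v₁, w, v₂)` with `dt(w) = dφ₁(v₁)` and `ds(w) = dφ₂(v₂)`, which is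
what infinitesimal essential surjectivity provides. -/
theorem Hom.IsEssentiallySurjective.surjective_modelDeriv_hpullOb
    (h : φ₁.IsEssentiallySurjective) (hO : IsObjectPullback φ₁ φ₂ dO) (p : HPullOb φ₁ φ₂) :
    Function.Surjective
      (modelDeriv (𝓡 dO) (𝓡 G₂.dimOb) (fun p : HPullOb φ₁ φ₂ => p.1.2.2) p) := by
  intro v₂
  obtain ⟨w, v₁, hwt, hws⟩ := h.exists_modelDeriv p.2.1
    (modelDeriv (𝓡 G₂.dimOb) (𝓡 G.dimOb) φ₂.ob p.1.2.2 v₂)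
  obtain ⟨t, ⟨ht, -⟩, -⟩ := hO.existsUnique_modelDeriv p (v := (v₁, v₂)) (w := w) (by
    rw [modelDeriv_prodMap ((φ₁.smooth_ob _).mdifferentiableAt (by simp))
      ((φ₂.smooth_ob _).mdifferentiableAt (by simp)), modelDeriv_anchor, hwt, hws])
  refine ⟨t, ?_⟩
  rw [modelDeriv_prodMk ((hO.smooth_left.fst p).mdifferentiableAt (by simp))
    ((hO.smooth_left.snd p).mdifferentiableAt (by simp))] at ht
  exact congrArg Prod.snd ht

/-- An arrow of the homotopy pullback along a fully faithful map is determined by its source, its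
target, and its component in the other groupoid. -/
theorem Hom.IsFullyFaithful.hpullAr_ext (h : φ₁.IsFullyFaithful) {k l : HPullAr φ₁ φ₂}
    (hs : hpullSrc k = hpullSrc l) (ht : hpullTgt k = hpullTgt l) (h₃ : k.1.2.2 = l.1.2.2) :
    k = l := by
  have hs₂ : G.str.mul k.1.2.1 (φ₂.ar k.1.2.2) k.2.2 = G.str.mul l.1.2.1 (φ₂.ar l.1.2.2) l.2.2 :=
    congrArg (fun p : HPullOb φ₁ φ₂ => p.1.2.1) hs
  have ht₂ : G.str.mul (φ₁.ar k.1.1) k.1.2.1 k.2.1 = G.str.mul (φ₁.ar l.1.1) l.1.2.1 l.2.1 :=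
    congrArg (fun p : HPullOb φ₁ φ₂ => p.1.2.1) ht
  -- Given the third component, the source determines the middle one by cancellation; the target
  -- then determines the image of the first under `φ₁`.
  have h₂ : k.1.2.1 = l.1.2.1 := G.str.mul_right_cancel k.2.2 (by rw [l.2.2, h₃])
    (hs₂.trans (G.str.mul_congr rfl (congrArg _ h₃.symm) _))
  have h₁ : φ₁.ar k.1.1 = φ₁.ar l.1.1 := G.str.mul_right_cancel k.2.1 (by rw [l.2.1, h₂])
    (ht₂.trans (G.str.mul_congr rfl h₂.symm _))
  refine LieGroupoid.hpullAr_ext (h.eq_of_eq h₁ (Prod.ext ?_ ?_)) h₂ h₃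
  · exact congrArg (fun p : HPullOb φ₁ φ₂ => p.1.1) ht
  · exact congrArg (fun p : HPullOb φ₁ φ₂ => p.1.1) hs

/-- Arrows of the homotopy pullback along a fully faithful map, with prescribed source, target and
component in the other groupoid. -/
theorem Hom.IsFullyFaithful.exists_hpullAr (h : φ₁.IsFullyFaithful) {k₃ : G₂.Ar}
    {b a : HPullOb φ₁ φ₂} (ht : G₂.str.tgt k₃ = b.1.2.2) (hs : G₂.str.src k₃ = a.1.2.2) :
    ∃ k : HPullAr φ₁ φ₂, k.1.2.2 = k₃ ∧ hpullTgt k = b ∧ hpullSrc k = a ∧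
      k.1.2.1 = G.str.mulTotal a.1.2.1 (G.str.inv (φ₂.ar k₃)) ∧
      φ₁.ar k.1.1 = G.str.mulTotal b.1.2.1 (G.str.inv k.1.2.1) := by
  have w₂ : G.str.src a.1.2.1 = G.str.tgt (G.str.inv (φ₂.ar k₃)) := by
    rw [G.str.tgt_inv, φ₂.src_ar, hs, a.2.2]
  -- Both `k₂` and the arrow to be lifted through `φ₁` are forced by the source and the target. The
  -- formulas are kept in the conclusion because smooth dependence is later read off from them.
  set k₂ := G.str.mul a.1.2.1 (G.str.inv (φ₂.ar k₃)) w₂ with hk₂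
  have hk₂s : G.str.src k₂ = G.str.tgt (φ₂.ar k₃) := by rw [hk₂, G.str.src_mul, G.str.src_inv]
  have hk₂t : G.str.tgt k₂ = φ₁.ob a.1.1 := by rw [hk₂, G.str.tgt_mul, a.2.1]
  have w₁ : G.str.src b.1.2.1 = G.str.tgt (G.str.inv k₂) := by
    rw [G.str.tgt_inv, hk₂s, φ₂.tgt_ar, ht, b.2.2]
  obtain ⟨k₁, hk₁, hk₁a⟩ := h.exists_of_eq (x := G.str.mul b.1.2.1 (G.str.inv k₂) w₁)
    (y := (b.1.1, a.1.1)) (by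
      refine Prod.ext ?_ ?_
      · exact (G.str.tgt_mul _ _ _).trans b.2.1
      · exact (G.str.src_mul _ _ _).trans ((G.str.src_inv _).trans hk₂t))
  have hk₁t : G₁.str.tgt k₁ = b.1.1 := congrArg Prod.fst hk₁a
  have hk₁s : G₁.str.src k₁ = a.1.1 := congrArg Prod.snd hk₁a
  refine ⟨⟨(k₁, k₂, k₃), by rw [φ₁.src_ar, hk₁s, hk₂t], hk₂s⟩, rfl, ?_, ?_, ?_, ?_⟩
  · refine hpullOb_ext hk₁t ?_ ht
    exact (G.str.mul_congr hk₁ rfl _).trans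
      (G.str.inv_mul_cancel_right _ _ (w₁.trans (G.str.tgt_inv _)))
  · exact hpullOb_ext hk₁s (G.str.inv_mul_cancel_right _ _ (w₂.trans (G.str.tgt_inv _))) hs
  · exact (G.str.mulTotal_eq w₂).symm
  · exact hk₁.trans (G.str.mulTotal_eq w₁).symm

/-- The base-change of a weak equivalence is fully faithful. -/
theorem Hom.IsWeakEquivalence.isGoodPullback_baseChange [IsManifold (𝓡 dO) ∞ (HPullOb φ₁ φ₂)]
    [IsManifold (𝓡 dA) ∞ (HPullAr φ₁ φ₂)] (h : φ₁.IsWeakEquivalence)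
    (hO : IsObjectPullback φ₁ φ₂ dO) (hA : IsArrowPullback φ₁ φ₂ dA) :
    IsGoodPullback (𝓡 dA) (𝓡 G₂.dimAr) ((𝓡 dO).prod (𝓡 dO))
      ((𝓡 G₂.dimOb).prod (𝓡 G₂.dimOb)) (fun k : HPullAr φ₁ φ₂ => k.1.2.2)
      hpullStr.anchor G₂.str.anchor
      (Prod.map (fun p : HPullOb φ₁ φ₂ => p.1.2.2) (fun p : HPullOb φ₁ φ₂ => p.1.2.2)) := by
  have hLie := isLie_hpullStr hO hA
  have hob : ContMDiff (𝓡 dO) (𝓡 G₂.dimOb) ∞ (fun p : HPullOb φ₁ φ₂ => p.1.2.2) :=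
    hO.smooth_left.snd
  have hobd := hob.mdifferentiable (n := ∞) (by simp)
  have htr : IsTransversal (𝓡 G₂.dimAr) ((𝓡 dO).prod (𝓡 dO)) ((𝓡 G₂.dimOb).prod (𝓡 G₂.dimOb))
      G₂.str.anchor
      (Prod.map (fun p : HPullOb φ₁ φ₂ => p.1.2.2) (fun p : HPullOb φ₁ φ₂ => p.1.2.2)) :=
    IsTransversal.of_surjective_right (surjective_modelDeriv_prodMap hobd hobd
      (h.2.surjective_modelDeriv_hpullOb hO) (h.2.surjective_modelDeriv_hpullOb hO))
  -- The candidate inverse must be defined on the whole product; away from the fibre product a unit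
  -- serves as an arbitrary value.
  have hex : ∀ w : G₂.Ar × (HPullOb φ₁ φ₂ × HPullOb φ₁ φ₂), ∃ k : HPullAr φ₁ φ₂,
      (G₂.str.anchor w.1 = (w.2.1.1.2.2, w.2.2.1.2.2)) →
      k.1.2.2 = w.1 ∧ hpullTgt k = w.2.1 ∧ hpullSrc k = w.2.2 ∧
        k.1.2.1 = G.str.mulTotal w.2.2.1.2.1 (G.str.inv (φ₂.ar w.1)) ∧
        φ₁.ar k.1.1 = G.str.mulTotal w.2.1.1.2.1 (G.str.inv k.1.2.1) := fun w => by
    by_cases hw : G₂.str.anchor w.1 = (w.2.1.1.2.2, w.2.2.1.2.2)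
    · obtain ⟨k, hk⟩ := h.1.exists_hpullAr (φ₂ := φ₂) (congrArg Prod.fst hw) (congrArg Prod.snd hw)
      exact ⟨k, fun _ => hk⟩
    · exact ⟨hpullUnit w.2.1, fun hw' => (hw hw').elim⟩
  choose θ hθ using hex
  refine htr.isGoodPullback_of_inverse (θ := θ) G₂.contMDiff_anchor (hob.prodMap hob)
    hA.smooth_left.snd (hLie.tgt_submersion.contMDiff.prodMk hLie.src_submersion.contMDiff)
    (fun _ => rfl) ?_ (fun k => ?_) (fun w hw => (hθ w hw).1)
    (fun w hw => Prod.ext (hθ w hw).2.1 (hθ w hw).2.2.1)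
  · set S := {w : G₂.Ar × (HPullOb φ₁ φ₂ × HPullOb φ₁ φ₂) | G₂.str.anchor w.1 =
      Prod.map (fun p : HPullOb φ₁ φ₂ => p.1.2.2) (fun p : HPullOb φ₁ φ₂ => p.1.2.2) w.2} with hS
    have c₃ : ContMDiffOn ((𝓡 G₂.dimAr).prod ((𝓡 dO).prod (𝓡 dO))) (𝓡 G₂.dimAr) ∞
        (fun w => (θ w).1.2.2) S := contMDiffOn_fst.congr fun w hw => (hθ w hw).1
    have cb : ContMDiff ((𝓡 G₂.dimAr).prod ((𝓡 dO).prod (𝓡 dO))) (𝓡 dO) ∞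
        (fun w : G₂.Ar × (HPullOb φ₁ φ₂ × HPullOb φ₁ φ₂) => w.2.1) :=
      contMDiff_fst.comp contMDiff_snd
    have ca : ContMDiff ((𝓡 G₂.dimAr).prod ((𝓡 dO).prod (𝓡 dO))) (𝓡 dO) ∞
        (fun w : G₂.Ar × (HPullOb φ₁ φ₂ × HPullOb φ₁ φ₂) => w.2.2) :=
      contMDiff_snd.comp contMDiff_snd
    have c₂ : ContMDiffOn ((𝓡 G₂.dimAr).prod ((𝓡 dO).prod (𝓡 dO))) (𝓡 G.dimAr) ∞
        (fun w => (θ w).1.2.1) S := by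
      refine (contMDiffOn_mulTotal (hO.smooth_right.comp ca).contMDiffOn
        (G.isLie.smooth_inv.comp (φ₂.smooth_ar.comp contMDiff_fst)).contMDiffOn
        fun w hw => ?_).congr fun w hw => (hθ w hw).2.2.2.1
      rw [Function.comp_apply, Function.comp_apply, Function.comp_apply, G.str.tgt_inv, φ₂.src_ar]
      exact w.2.2.2.2.trans (congrArg _ (congrArg Prod.snd hw).symm)
    -- The first component is known only through its image under `φ₁` and its end points. It is
    -- smooth because full faithfulness of `φ₁` is a good pullback of manifolds, not merely a
    -- bijection.
    have c₁ : ContMDiffOn ((𝓡 G₂.dimAr).prod ((𝓡 dO).prod (𝓡 dO))) (𝓡 G₁.dimAr) ∞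
        (fun w => (θ w).1.1) S := by
      refine h.1.contMDiffOn ?_ ?_
      · refine (contMDiffOn_mulTotal (hO.smooth_right.comp cb).contMDiffOn
          (G.isLie.smooth_inv.comp_contMDiffOn c₂) fun w hw => ?_).congr
          fun w hw => (hθ w hw).2.2.2.2
        rw [Function.comp_apply, Function.comp_apply, G.str.tgt_inv, (θ w).2.2, φ₂.tgt_ar, (hθ w hw).1]
        exact w.2.1.2.2.trans (congrArg _ (congrArg Prod.fst hw).symm)
      · refine ((hO.smooth_left.fst.comp cb).prodMk
          (hO.smooth_left.fst.comp ca)).contMDiffOn.congr fun w hw => Prod.ext ?_ ?_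
        · exact congrArg (fun p : HPullOb φ₁ φ₂ => p.1.1) (hθ w hw).2.1
        · exact congrArg (fun p : HPullOb φ₁ φ₂ => p.1.1) (hθ w hw).2.2.1
    exact hA.contMDiffOn (c₁.prodMk c₃) c₂
  · have hk := hθ (k.1.2.2, hpullStr.anchor k) rfl
    exact h.1.hpullAr_ext hk.2.2.1 hk.2.1 hk.1

end BaseChange

/-- The base-change of a weak equivalence is a surjective equivalence. -/
theorem HomotopyPullback.isSurjectiveEquivalence_baseChange (h : φ₁.IsWeakEquivalence)
    (P : HomotopyPullback φ₁ φ₂) : P.baseChange.IsSurjectiveEquivalence := by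
  let _ := P.chartedOb
  let _ := P.chartedAr
  have _ := P.mfdOb
  have _ := P.mfdAr
  refine ⟨⟨h.2.surjective_hpullOb φ₂, ?_⟩, h.isGoodPullback_baseChange P.pullbackOb P.pullbackAr⟩
  exact isSubmersion_of_surjective_mfderiv P.pullbackOb.smooth_left.snd
    (h.2.surjective_modelDeriv_hpullOb P.pullbackOb)

end HomotopyPullback

end LieGroupoid

/-- If `φ₁` is a weak equivalence, then the homotopy pullback of `φ₁` and `φ₂` exists and the
base-change of `φ₁` is a surjective equivalence. -/
theorem mainTheorem10 {G G₁ G₂ : LieGroupoid.{u}} (φ₁ : LieGroupoid.Hom G₁ G)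
    (φ₂ : LieGroupoid.Hom G₂ G) (hφ₁ : φ₁.IsWeakEquivalence) :
    Nonempty (LieGroupoid.HomotopyPullback φ₁ φ₂) ∧
      ∀ P : LieGroupoid.HomotopyPullback φ₁ φ₂, P.baseChange.IsSurjectiveEquivalence :=
  ⟨hφ₁.2.nonempty_homotopyPullback φ₂,
    LieGroupoid.HomotopyPullback.isSurjectiveEquivalence_baseChange hφ₁⟩
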